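/- Let $\mathbb F_q$ be a finite field and $W$ a finite-dimensional $\mathbb F_q$-vector space of dimension $n$ with a flag $\mathcal F$ of subspaces $\{0\}=F_0(W)\subsetneq F_1(W)\subsetneq\cdots\subsetneq F_\ell(W)=W$, and put $r_i=\dim F_i(W)$. Let $P_{\mathcal F}\le GL(W)$ be the stabiliser of the flag, let $\mathcal M_{\mathcal F}=\{\varphi\in\mathrm{Hom}(W,W): \varphi(F_i(W))\subseteq F_i(W)\text{ for all } i\}$, and let $G_1,G_2$ be subgroups of $P_{\mathcal F}$. Put $W_1=W_2=W$ and $V=W_1\oplus W_2$. The parabolic gluing $G_1\times_{\mathcal F}G_2$ is the group of triples $(g_1,\varphi,g_2)\in G_1\times\mathcal M_{\mathcal F}\times G_2$ with product $(g_1,\varphi,g_2)(g_1',\varphi',g_2')=(g_1g_1',\,g_1\varphi'+\varphi g_2',\,g_2g_2')$; it acts on $V$ by $(g_1,\varphi,g_2)(w_1\oplus w_2)=(g_1w_1+\varphi(w_2))\oplus g_2w_2$. For a vector space $U$, $\mathbb F_q[U]$ denotes the symmetric algebra on $U^*$ and $\mathbb F_q(U)$ its field of fractions; a group acting on $U$ acts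 on these from the right by $(\phi\cdot g)(u)=\phi(gu)$ for $\phi\in U^*$. Both $\mathbb F_q[W_1]$ and $\mathbb F_q[W_2]$ are regarded as subalgebras of $\mathbb F_q[V]$. Let $y_1,\dots,y_n$ be a basis of $W_1^*$ consistent with the flag, that is, for every $i$ the linear forms vanishing on $F_i(W_1)$ are spanned by $y_{r_i+1},\dots,y_n$. For $0\le i<\ell$ let $\widetilde U_{i+1}\subseteq W_2^*$ be the space of linear forms vanishing on $F_i(W_2)$, and let $N_{i+1}(t)=\prod_{u\in\widetilde U_{i+1}}(t+u)$. Let $f_1,\dots,f_n\in\mathbb F_q[W_1]$ be homogeneous polynomials consistent with the flag, that is, $f_j\in\mathbb F_q[y_{r_i+1},\dots,y_n]$ whenever $r_i<j\le r_{i+1}$; in that case let $\widetilde f_j\in\mathbb F_q[V]$ be the polynomial obtained from $f_j$ by substituting $N_{i+1}(y_k)$ for each $y_k$. Suppose that $\mathbb F_q(W_1)^{G_1}=\mathbb F_q(f_1,\dots,f_n)$. Then $\mathbb F_q(V)^{G_1\times_{\mathcal F}G_2}$ is $\mathbb F_q(\widetilde f_1,\dots,\widetilde f_n)\otimes\mathbb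 F_q(W_2)^{G_2}$ in the sense of fields: it is the subfield of $\mathbb F_q(V)$ generated by $\mathbb F_q(\widetilde f_1,\dots,\widetilde f_n)$ and $\mathbb F_q(W_2)^{G_2}$, and these two subfields are linearly disjoint over $\mathbb F_q$ (the multiplication map from their tensor product over $\mathbb F_q$ to $\mathbb F_q(V)$ is injective). -/

import Mathlib

open Module

noncomputable section

namespace ParGlue

section Invariants

variable (F : Type*) [Field F]

/-- `F[V]`: the symmetric algebra on the dual space of `V`. -/
abbrev PolyRing (V : Type*) [AddCommGroup V] [Module F V] : Type _ :=
  SymmetricAlgebra F (Dual F V)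

/-- `F(V)`: the field of fractions of `F[V]`. -/
def RatField (V : Type*) [AddCommGroup V] [Module F V] : Type _ :=
  FractionRing (PolyRing F V)

instance (V : Type*) [AddCommGroup V] [Module F V] : Field (RatField F V) :=
  inferInstanceAs (Field (FractionRing (PolyRing F V)))

instance (V : Type*) [AddCommGroup V] [Module F V] : Algebra (PolyRing F V) (RatField F V) :=
  inferInstanceAs (Algebra (PolyRing F V) (FractionRing (PolyRing F V)))

instance (V : Type*) [AddCommGroup V] [Module F V] :
    IsFractionRing (PolyRing F V) (RatField F V) :=
  inferInstanceAs (IsFractionRing (PolyRing F V) (FractionRing (PolyRing F V)))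

instance (V : Type*) [AddCommGroup V] [Module F V] : Algebra F (RatField F V) :=
  inferInstanceAs (Algebra F (FractionRing (PolyRing F V)))

instance (V : Type*) [AddCommGroup V] [Module F V] :
    IsScalarTower F (PolyRing F V) (RatField F V) :=
  inferInstanceAs (IsScalarTower F (PolyRing F V) (FractionRing (PolyRing F V)))

variable {F}
variable {V V' V'' : Type*} [AddCommGroup V] [Module F V] [AddCommGroup V'] [Module F V']
  [AddCommGroup V''] [Module F V'']

/-- The algebra map `F[V'] → F[V]` which extends the map `φ ↦ φ ∘ T` on linear forms. -/
def polyPullback (T : V →ₗ[F] V') : PolyRing F V' →ₐ[F] PolyRing F V :=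
  SymmetricAlgebra.lift (SymmetricAlgebra.ι F (Dual F V) ∘ₗ T.dualMap)

theorem polyPullback_ι (T : V →ₗ[F] V') (φ : Dual F V') :
    polyPullback T (SymmetricAlgebra.ι F (Dual F V') φ)
      = SymmetricAlgebra.ι F (Dual F V) (φ ∘ₗ T) := by
  simp [polyPullback, LinearMap.dualMap_apply']

theorem polyPullback_comp (S : V →ₗ[F] V') (T : V' →ₗ[F] V'') :
    (polyPullback S).comp (polyPullback T) = polyPullback (T ∘ₗ S) := by
  apply SymmetricAlgebra.algHom_ext
  ext φ
  simp [polyPullback_ι, LinearMap.comp_assoc]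

theorem polyPullback_id : polyPullback (LinearMap.id : V →ₗ[F] V) = AlgHom.id F _ := by
  apply SymmetricAlgebra.algHom_ext
  ext φ
  simp [polyPullback_ι]

theorem polyPullback_injective (T : V →ₗ[F] V') (hT : Function.Surjective T) :
    Function.Injective (polyPullback T) := by
  obtain ⟨S, hS⟩ := T.exists_rightInverse_of_surjective (LinearMap.range_eq_top.2 hT)
  have h : (polyPullback S).comp (polyPullback T) = AlgHom.id F _ := by
    rw [polyPullback_comp, hS, polyPullback_id]
  exact Function.LeftInverse.injective (g := polyPullback S) fun x => by
    simpa using DFunLike.congr_fun h x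

theorem algebraMap_comp_polyPullback_injective (T : V →ₗ[F] V') (hT : Function.Surjective T) :
    Function.Injective
      ((IsScalarTower.toAlgHom F (PolyRing F V) (RatField F V)).comp (polyPullback T)) :=
  (IsFractionRing.injective (PolyRing F V) (RatField F V)).comp (polyPullback_injective T hT)

/-- The embedding of fields `F(V') → F(V)` induced by a surjective linear map `V → V'`. -/
def ratPullback (T : V →ₗ[F] V') (hT : Function.Surjective T) :
    RatField F V' →ₐ[F] RatField F V :=
  IsFractionRing.liftAlgHom (algebraMap_comp_polyPullback_injective T hT)

theorem ratPullback_algebraMap (T : V →ₗ[F] V') (hT : Function.Surjective T) (f : PolyRing F V') :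
    ratPullback T hT (algebraMap _ _ f) = algebraMap _ _ (polyPullback T f) :=
  IsFractionRing.lift_algebraMap (algebraMap_comp_polyPullback_injective T hT) f

/-- The right action `x ↦ x · g` of `g ∈ GL(V)` on `F(V)`; on linear forms, `φ · g = φ ∘ g`. -/
def ratAct (g : V ≃ₗ[F] V) : RatField F V →ₐ[F] RatField F V :=
  ratPullback g.toLinearMap g.surjective

/-- `F(V)^G`, for a representation `V` of `G`, as an intermediate field of `F(V)` over `F`. -/
def invariantField {G : Type*} [Group G] (ρ : G →* (V ≃ₗ[F] V)) :
    IntermediateField F (RatField F V) where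
  carrier := {x | ∀ g : G, ratAct (ρ g) x = x}
  mul_mem' ha hb g := by rw [map_mul, ha g, hb g]
  add_mem' ha hb g := by rw [map_add, ha g, hb g]
  algebraMap_mem' r g := AlgHom.commutes _ r
  inv_mem' x hx g := by rw [map_inv₀, hx g]

/-- The subfield `F(f_j : j)` of `F(V)` generated over `F` by a family in `F[V]`. -/
def genField {ι : Type*} (f : ι → PolyRing F V) : IntermediateField F (RatField F V) :=
  IntermediateField.adjoin F (Set.range fun j => algebraMap (PolyRing F V) (RatField F V) (f j))

/-- `f ∈ F[V]` is homogeneous: for some `d`, it is a sum of products of `d` linear forms. -/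
def IsHomogeneousPoly (f : PolyRing F V) : Prop :=
  ∃ d : ℕ, f ∈ LinearMap.range (SymmetricAlgebra.ι F (Dual F V)) ^ d

end Invariants

/-- A flag `{0} = F_0(W) < F_1(W) < ⋯ < F_ℓ(W) = W` of subspaces of `W`. -/
structure PartialFlag (F W : Type*) [Field F] [AddCommGroup W] [Module F W] (ℓ : ℕ) where
  space : Fin (ℓ + 1) → Submodule F W
  strictMono : StrictMono space
  space_zero : space 0 = ⊥
  space_last : space (Fin.last ℓ) = ⊤

namespace PartialFlag

variable {F W : Type*} [Field F] [AddCommGroup W] [Module F W] {ℓ : ℕ}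

/-- The parabolic subgroup of `GL(W)`: the stabiliser of the flag. -/
def parabolic (E : PartialFlag F W ℓ) : Subgroup (W ≃ₗ[F] W) where
  carrier := {g | ∀ i, (E.space i).map g.toLinearMap = E.space i}
  mul_mem' {a b} ha hb i := by
    have h : (a * b).toLinearMap = a.toLinearMap ∘ₗ b.toLinearMap := rfl
    rw [h, Submodule.map_comp, hb i, ha i]
  one_mem' i := Submodule.map_id _
  inv_mem' {a} ha i := by
    have h : (a⁻¹).toLinearMap ∘ₗ a.toLinearMap = LinearMap.id := by
      ext x
      exact a.symm_apply_apply x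
    conv_lhs => rw [← ha i]
    rw [← Submodule.map_comp, h, Submodule.map_id]

/-- The linear maps `φ : W → W` with `φ(F_i(W)) ⊆ F_i(W)` for all `i`. -/
def endos (E : PartialFlag F W ℓ) : Submodule F (W →ₗ[F] W) where
  carrier := {φ | ∀ i, ∀ w : W, w ∈ E.space i → φ w ∈ E.space i}
  add_mem' ha hb i w hw := add_mem (ha i w hw) (hb i w hw)
  zero_mem' i w _ := zero_mem _
  smul_mem' c _ ha i w hw := Submodule.smul_mem _ c (ha i w hw)

theorem parabolic_mem_endos (E : PartialFlag F W ℓ) (g : E.parabolic) :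
    (g : W ≃ₗ[F] W).toLinearMap ∈ E.endos := by
  intro i w hw
  rw [← g.2 i]
  exact Submodule.mem_map_of_mem hw

theorem comp_mem_endos (E : PartialFlag F W ℓ) {φ ψ : W →ₗ[F] W} (hφ : φ ∈ E.endos)
    (hψ : ψ ∈ E.endos) : φ ∘ₗ ψ ∈ E.endos :=
  fun i w hw => hφ i _ (hψ i w hw)

/-- `r_i = dim F_i(W)`. -/
def r (E : PartialFlag F W ℓ) (i : Fin (ℓ + 1)) : ℕ := finrank F (E.space i)

theorem exists_r_le (E : PartialFlag F W ℓ) (j : ℕ) :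
    (Finset.univ.filter fun i => E.r i ≤ j).Nonempty :=
  ⟨0, Finset.mem_filter.2 ⟨Finset.mem_univ _, by
    rw [r, E.space_zero, finrank_bot]
    exact Nat.zero_le j⟩⟩

/-- The largest `i` with `r_i ≤ j`. Variables are numbered from `0`, so that for `j < dim W` this
is the index `i` with `r_i < j + 1 ≤ r_{i+1}`. -/
def level (E : PartialFlag F W ℓ) (j : ℕ) : Fin (ℓ + 1) :=
  (Finset.univ.filter fun i => E.r i ≤ j).max' (E.exists_r_le j)

theorem r_level_le (E : PartialFlag F W ℓ) (j : ℕ) : E.r (E.level j) ≤ j :=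
  (Finset.mem_filter.1 (Finset.max'_mem _ (E.exists_r_le j))).2

theorem lt_r_of_level_lt (E : PartialFlag F W ℓ) (j : ℕ) (i : Fin (ℓ + 1)) (h : E.level j < i) :
    j < E.r i := by
  rcases Nat.lt_or_ge j (E.r i) with hi | hi
  · exact hi
  · have hm : i ∈ Finset.univ.filter fun i => E.r i ≤ j :=
      Finset.mem_filter.2 ⟨Finset.mem_univ _, hi⟩
    have h' : i ≤ E.level j := by
      unfold level
      exact Finset.le_max' _ i hm
    exact absurd h' (not_le.2 h)

/-- A basis `y_0, …, y_{n-1}` of `W^*` is consistent with the flag: for all `i`, the image of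
`(W / F_i(W))^*` in `W^*`, i.e. the annihilator of `F_i(W)`, is spanned by the `y_k` with
`r_i ≤ k`. -/
def BasisConsistent (E : PartialFlag F W ℓ) {n : ℕ} (y : Basis (Fin n) F (Dual F W)) : Prop :=
  ∀ i, (E.space i).dualAnnihilator = Submodule.span F {φ | ∃ k : Fin n, E.r i ≤ k ∧ φ = y k}

/-- A sequence `f_0, …, f_{n-1}` in `F[W]` is consistent with the flag: `f_j` is a polynomial in
the `y_k` with `r_i ≤ k`, where `r_i ≤ j < r_{i+1}`. -/
def SeqConsistent (E : PartialFlag F W ℓ) {n : ℕ} (y : Basis (Fin n) F (Dual F W))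
    (f : Fin n → PolyRing F W) : Prop :=
  ∀ j : Fin n, f j ∈ Algebra.adjoin F
    {z | ∃ k : Fin n, E.r (E.level j) ≤ k ∧ z = SymmetricAlgebra.ι F (Dual F W) (y k)}

/-- The orbit product `N_{i+1}(y) = ∏ (y + u)` in `F[W ⊕ W]`, where `y` is a linear form on the
first summand, and `u` runs over the linear forms on the second summand which vanish on `F_i(W)`
(a finite set when `F` is finite). -/
def orbitProd (E : PartialFlag F W ℓ) (i : Fin (ℓ + 1)) (y : Dual F W) : PolyRing F (W × W) :=
  ∏ᶠ u : (E.space i).dualAnnihilator,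
    (SymmetricAlgebra.ι F (Dual F (W × W)) (y ∘ₗ LinearMap.fst F W W)
      + SymmetricAlgebra.ι F (Dual F (W × W)) ((u : Dual F W) ∘ₗ LinearMap.snd F W W))

/-- The result of substituting `N_{i+1}(y_k)` for every `y_k` in `f`. -/
def subst (E : PartialFlag F W ℓ) {n : ℕ} (y : Basis (Fin n) F (Dual F W)) (i : Fin (ℓ + 1))
    (f : PolyRing F W) : PolyRing F (W × W) :=
  MvPolynomial.aeval (fun k => E.orbitProd i (y k)) (SymmetricAlgebra.equivMvPolynomial y f)

/-- The sequence `f̃_j`: substitute `N_{i+1}(y_k)` for `y_k` in `f_j`, where `r_i ≤ j < r_{i+1}`. -/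
def tilde (E : PartialFlag F W ℓ) {n : ℕ} (y : Basis (Fin n) F (Dual F W))
    (f : Fin n → PolyRing F W) (j : Fin n) : PolyRing F (W × W) :=
  E.subst y (E.level j) (f j)

/-- The representation on `W` of a subgroup of the parabolic subgroup. -/
def stdRep (E : PartialFlag F W ℓ) (G : Subgroup E.parabolic) : G →* (W ≃ₗ[F] W) :=
  E.parabolic.subtype.comp G.subtype

/-- The subfield `F(W₂)^G` of `F(W₁ ⊕ W₂)`, where `W₁ = W₂ = W`: linear forms on `W₂` are regarded
as linear forms on `W₁ ⊕ W₂` through the projection to the second summand. -/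
def sndInvariantField (E : PartialFlag F W ℓ) (G : Subgroup E.parabolic) :
    IntermediateField F (RatField F (W × W)) :=
  (invariantField (E.stdRep G)).map
    (ratPullback (LinearMap.snd F W W) LinearMap.snd_surjective)

end PartialFlag

/-- The elements `(g₁, φ, g₂)` of the parabolic gluing of `G₁` to `G₂`. -/
@[ext]
structure ParabolicGluing {F W : Type*} [Field F] [AddCommGroup W] [Module F W] {ℓ : ℕ}
    (E : PartialFlag F W ℓ) (G₁ G₂ : Subgroup E.parabolic) where
  left : G₁
  mid : E.endos
  right : G₂

namespace ParabolicGluing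

variable {F W : Type*} [Field F] [AddCommGroup W] [Module F W] {ℓ : ℕ}
  {E : PartialFlag F W ℓ} {G₁ G₂ : Subgroup E.parabolic}

/-- The linear map `g₁ ∘ φ`. -/
def lmul (g : G₁) (φ : E.endos) : E.endos :=
  ⟨(E.stdRep G₁ g).toLinearMap ∘ₗ φ, E.comp_mem_endos (E.parabolic_mem_endos g.1) φ.2⟩

/-- The linear map `φ ∘ g₂`. -/
def rmul (φ : E.endos) (g : G₂) : E.endos :=
  ⟨φ ∘ₗ (E.stdRep G₂ g).toLinearMap, E.comp_mem_endos φ.2 (E.parabolic_mem_endos g.1)⟩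

theorem lmul_apply (g : G₁) (φ : E.endos) (w : W) :
    (lmul g φ : W →ₗ[F] W) w = E.stdRep G₁ g ((φ : W →ₗ[F] W) w) := rfl

theorem rmul_apply (φ : E.endos) (g : G₂) (w : W) :
    (rmul φ g : W →ₗ[F] W) w = (φ : W →ₗ[F] W) (E.stdRep G₂ g w) := rfl

/-- `(g₁, φ, g₂) (g₁', φ', g₂') = (g₁ g₁', g₁ φ' + φ g₂', g₂ g₂')`. -/
instance : Mul (ParabolicGluing E G₁ G₂) where
  mul a b := ⟨a.left * b.left, lmul a.left b.mid + rmul a.mid b.right, a.right * b.right⟩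

instance : One (ParabolicGluing E G₁ G₂) where
  one := ⟨1, 0, 1⟩

instance : Inv (ParabolicGluing E G₁ G₂) where
  inv a := ⟨a.left⁻¹, -lmul a.left⁻¹ (rmul a.mid a.right⁻¹), a.right⁻¹⟩

theorem mul_def (a b : ParabolicGluing E G₁ G₂) :
    a * b = ⟨a.left * b.left, lmul a.left b.mid + rmul a.mid b.right, a.right * b.right⟩ := rfl

theorem one_def : (1 : ParabolicGluing E G₁ G₂) = ⟨1, 0, 1⟩ := rfl

theorem inv_def (a : ParabolicGluing E G₁ G₂) :
    a⁻¹ = ⟨a.left⁻¹, -lmul a.left⁻¹ (rmul a.mid a.right⁻¹), a.right⁻¹⟩ := rfl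

instance : Group (ParabolicGluing E G₁ G₂) :=
  Group.ofLeftAxioms
    (fun a b c => by
      simp only [mul_def]
      refine ParabolicGluing.ext (mul_assoc _ _ _) ?_ (mul_assoc _ _ _)
      apply Subtype.ext
      ext w
      simp [lmul_apply, rmul_apply, add_assoc])
    (fun a => by
      simp only [mul_def, one_def]
      refine ParabolicGluing.ext (one_mul _) ?_ (one_mul _)
      apply Subtype.ext
      ext w
      simp [lmul_apply, rmul_apply])
    (fun a => by
      simp only [mul_def, one_def, inv_def]
      refine ParabolicGluing.ext (inv_mul_cancel _) ?_ (inv_mul_cancel _)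
      apply Subtype.ext
      ext w
      have h : E.stdRep G₂ a.right⁻¹ (E.stdRep G₂ a.right w) = w := by
        rw [← LinearEquiv.mul_apply, ← map_mul, inv_mul_cancel, map_one, LinearEquiv.coe_one, id]
      simp [lmul_apply, rmul_apply, -map_inv, h])

/-- The linear map `w₁ ⊕ w₂ ↦ (g₁ w₁ + φ(w₂)) ⊕ g₂ w₂`. -/
def toLin (a : ParabolicGluing E G₁ G₂) : (W × W) →ₗ[F] (W × W) :=
  LinearMap.prod
    ((E.stdRep G₁ a.left).toLinearMap ∘ₗ LinearMap.fst F W W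
      + (a.mid : W →ₗ[F] W) ∘ₗ LinearMap.snd F W W)
    ((E.stdRep G₂ a.right).toLinearMap ∘ₗ LinearMap.snd F W W)

theorem toLin_apply (a : ParabolicGluing E G₁ G₂) (w : W × W) :
    a.toLin w = (E.stdRep G₁ a.left w.1 + (a.mid : W →ₗ[F] W) w.2, E.stdRep G₂ a.right w.2) := rfl

theorem toLin_mul (a b : ParabolicGluing E G₁ G₂) : (a * b).toLin = a.toLin ∘ₗ b.toLin := by
  apply LinearMap.ext
  intro w
  simp [toLin_apply, mul_def, lmul_apply, rmul_apply, add_assoc]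

theorem toLin_one : (1 : ParabolicGluing E G₁ G₂).toLin = LinearMap.id := by
  apply LinearMap.ext
  intro w
  simp [toLin_apply, one_def]

/-- The representation of the gluing on `V = W ⊕ W`. -/
def rep : ParabolicGluing E G₁ G₂ →* ((W × W) ≃ₗ[F] (W × W)) where
  toFun a := LinearEquiv.ofLinearMap a.toLin (a⁻¹).toLin
    (by rw [← toLin_mul, mul_inv_cancel, toLin_one])
    (by rw [← toLin_mul, inv_mul_cancel, toLin_one])
  map_one' := by
    apply LinearEquiv.toLinearMap_injective
    exact toLin_one
  map_mul' a b := by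
    apply LinearEquiv.toLinearMap_injective
    exact toLin_mul a b

end ParabolicGluing

end ParGlue

end

/-!
The group `G = G₁ ×_F G₂` acts on `F(V)`. Write `L = F(W₂)`, let `K` be the field generated by
the `f̃_j` and `L^{G₂}`, and let `A_i = F(W/F_i)` be the field generated by the linear forms in the
annihilator of `F_i`.

Because the annihilator `U` of `F_i(W₂)` is a finite `F`-vector space, `N_{i+1}(t) = ∏ (t + u)` is
an additive, `F`-linear polynomial (`prod_add_add`, `prod_smul_add`). Substituting `N_{i+1}` in
linear forms is therefore a basis-free embedding `N_{i+1} : F(W₁) → F(V)`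
(`PartialFlag.orbitHom`): setting the variables of `W₂` to zero turns it into a power of the
Frobenius map, whence its injectivity. On `A_i` it intertwines `(g₁, φ, g₂)` with `g₁`, since
`y ∘ φ ∈ U` for `y` in the annihilator of `F_i(W₁)`. This gives `K ⊆ F(V)^G`
(`sup_le_invariantField`).

For the converse, the `f_j` are algebraically independent, so `F(f_k : k > r_i)` is algebraically
closed in `F(f_1, …, f_n)`; hence an element of `A_i` which is fixed by `G₁` is a rational
function of the `f_k` with `k > r_i` (`PartialFlag.mem_adjoin_of_mem_levelField`). As `f̃_k ∈ K`
for `k` in the block `r_i < k ≤ r_{i+1}`, a subfield of `F(V)` which contains `K`, `L` and the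
forms on `W₁` vanishing on `F_{i+1}` contains `N_{i+1}(A_i^{G₁})` (`PartialFlag.orbitHom_mem`). This
makes descending inductions on `i` possible. The first shows that `F(V)` is separable over `K`
(`isSeparable_over_sup`). The second shows that an embedding `σ` of `F(V)` over `K` into an
algebraically closed field is the action of an element of `G` (`exists_comp_ratAct_eq`): `σ` can be
corrected by an element of `G₂` to fix `L`, and, once it fixes the forms vanishing on `F_{i+1}`, by
an element of `G₁` to fix `N_{i+1}(y)` for all `y` vanishing on `F_i`; then `σ(y) - y` is a root
of `N_{i+1}`, thus an element of `U`, and an element `(1, φ, 1)` corrects it to `0`. Hence every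
`x ∈ F(V)^G` is fixed by all embeddings over `K`, and so lies in `K`.

Finally, `F(V)` is algebraic over the field generated by the `2n` elements consisting of the `f̃_j`
and a basis of the forms on `W₂`. They are then algebraically independent, and the linear
disjointness follows (`linearDisjoint_adjoin_of_algebraicIndependent`).

The variables and the `f_j` are numbered from `1` in this text and from `0` in the formal
statements, where the condition `k > r_i` becomes `r_i ≤ k`.
-/

namespace ParGlue

/-! ### Algebraic independence -/

section FieldTheory

open scoped IntermediateField.algebraAdjoinAdjoin

/-- The monomials in `v` are a basis of `F[v]` and are linearly independent over `B`, so `F[v]` and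
`B` are linearly disjoint; this passes to the field of fractions `F(v)`. -/
theorem linearDisjoint_adjoin_of_algebraicIndependent {F E ι : Type*} [Field F] [Field E]
    [Algebra F E] (B : IntermediateField F E) {v : ι → E} (hv : AlgebraicIndependent B v) :
    (IntermediateField.adjoin F (Set.range v)).LinearDisjoint B := by
  have hvF : AlgebraicIndependent F v := hv.restrictScalars (algebraMap F B).injective
  have key : (Algebra.adjoin F (Set.range v)).LinearDisjoint B.toSubalgebra := by
    refine Subalgebra.LinearDisjoint.of_basis_left _ _
      ((MvPolynomial.basisMonomials ι F).map hvF.aevalEquiv.toLinearEquiv) ?_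
    have h := (MvPolynomial.basisMonomials ι B).linearIndependent.map'
      (MvPolynomial.aeval v : MvPolynomial ι B →ₐ[B] E).toLinearMap
      (LinearMap.ker_eq_bot.2 hv)
    have e : (Algebra.adjoin F (Set.range v)).val ∘
          (MvPolynomial.basisMonomials ι F).map hvF.aevalEquiv.toLinearEquiv
        = (MvPolynomial.aeval v : MvPolynomial ι B →ₐ[B] E).toLinearMap ∘
          MvPolynomial.basisMonomials ι B := by
      funext m
      simp [MvPolynomial.aeval_monomial]
    rw [e]
    exact h
  refine IntermediateField.LinearDisjoint.of_basis_right (Basis.ofVectorSpace F B) ?_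
  have h2 := key.linearIndependent_right_of_flat (b := Basis.ofVectorSpace F B)
    (Basis.ofVectorSpace F B).linearIndependent
  exact (LinearIndependent.iff_fractionRing (R := Algebra.adjoin F (Set.range v))
    (K := IntermediateField.adjoin F (Set.range v))).1 h2

/-- For algebraically independent `v`, the field `F(v i : i ∈ s)` is algebraically closed in
`F(v)`: the remaining `v i` are algebraically independent over its algebraic closure in `E`, and
linear disjointness bounds the intersection. -/
theorem mem_adjoin_image_of_isAlgebraic {F E ι : Type*} [Field F] [Field E]
    [Algebra F E] {v : ι → E} (hv : AlgebraicIndependent F v) (s : Set ι) {x : E}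
    (hx : x ∈ IntermediateField.adjoin F (Set.range v))
    (hxs : IsAlgebraic (IntermediateField.adjoin F (v '' s)) x) :
    x ∈ IntermediateField.adjoin F (v '' s) := by
  set K := IntermediateField.adjoin F (v '' s) with hK
  have h1 : AlgebraicIndependent K (fun i : ↥sᶜ => v i) :=
    IntermediateField.algebraicIndependent_adjoin_iff.2
      ((AlgebraicIndependent.iff_adjoin_image s).1 hv).2
  have h2 : AlgebraicIndependent (algebraicClosure K E) (fun i : ↥sᶜ => v i) := h1.extendScalars _
  have h3 := (linearDisjoint_adjoin_of_algebraicIndependent _ h2).inf_eq_bot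
  have h4 : x ∈ IntermediateField.adjoin K (Set.range fun i : ↥sᶜ => v i) := by
    have : IntermediateField.adjoin F (Set.range v) ≤
        (IntermediateField.adjoin K (Set.range fun i : ↥sᶜ => v i)).restrictScalars F := by
      rw [IntermediateField.adjoin_le_iff]
      rintro _ ⟨i, rfl⟩
      by_cases hi : i ∈ s
      · exact IntermediateField.algebraMap_mem _
          (⟨v i, IntermediateField.subset_adjoin F _ ⟨i, hi, rfl⟩⟩ : K)
      · exact IntermediateField.subset_adjoin K _ ⟨⟨i, hi⟩, rfl⟩
    exact this hx
  have h5 : x ∈ (⊥ : IntermediateField K E) := by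
    rw [← h3]
    exact ⟨h4, mem_algebraicClosure_iff.2 hxs⟩
  obtain ⟨y, rfl⟩ := IntermediateField.mem_bot.1 h5
  exact y.2

/-- As many algebraically independent elements of `F(v)` as there are generators form a
transcendence basis of `F(v)`. -/
theorem isAlgebraic_adjoin_of_algebraicIndependent {F E ι : Type*} [Field F] [Field E]
    [Algebra F E] [Finite ι] {v w : ι → E} (hw : AlgebraicIndependent F w)
    (hwv : ∀ i, w i ∈ IntermediateField.adjoin F (Set.range v)) {x : E}
    (hx : x ∈ IntermediateField.adjoin F (Set.range v)) :
    IsAlgebraic (IntermediateField.adjoin F (Set.range w)) x := by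
  set A := IntermediateField.adjoin F (Set.range v) with hA
  let w' : ι → A := fun i => ⟨w i, hwv i⟩
  let v' : ι → A := fun i => ⟨v i, IntermediateField.subset_adjoin F _ ⟨i, rfl⟩⟩
  have hw' : AlgebraicIndependent F w' := AlgebraicIndependent.of_comp A.val (by exact hw)
  have hv' : IntermediateField.adjoin F (Set.range v') = ⊤ := by
    apply IntermediateField.map_injective A.val
    rw [IntermediateField.adjoin_map, ← Set.range_comp, ← AlgHom.fieldRange_eq_map,
      IntermediateField.fieldRange_val]
    rfl
  have : Algebra.IsAlgebraic (Algebra.adjoin F (Set.range v')) A := by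
    rw [← IntermediateField.isAlgebraic_adjoin_iff_top, hv']
    infer_instance
  have hb : IsTranscendenceBasis F w' := by
    refine hw'.isTranscendenceBasis_of_lift_trdeg_le_of_finite ?_
    refine (Cardinal.lift_le.2 (Algebra.IsAlgebraic.trdeg_le_cardinalMk F (Set.range v'))).trans ?_
    exact Cardinal.mk_range_le_lift
  have h6 : IsAlgebraic (IntermediateField.adjoin F (Set.range w')) (⟨x, hx⟩ : A) :=
    hb.isAlgebraic_field.isAlgebraic ⟨x, hx⟩
  have h7 : ∀ z : IntermediateField.adjoin F (Set.range w'),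
      A.val z ∈ IntermediateField.adjoin F (Set.range w) := by
    intro z
    have h8 : (IntermediateField.adjoin F (Set.range w')).map A.val
        = IntermediateField.adjoin F (Set.range w) := by
      rw [IntermediateField.adjoin_map, ← Set.range_comp]
      rfl
    rw [← h8]
    exact ⟨z, z.2, rfl⟩
  exact h6.ringHom_of_comp_eq
    ((A.val.comp (IntermediateField.val _)).codRestrict
      (IntermediateField.adjoin F (Set.range w)).toSubalgebra h7).toRingHom
    A.val.toRingHom (RingHom.injective _) rfl

/-- If `E` is algebraic over `F(v)` and contains an algebraically independent family `w` at least
as large as `v`, then `v` is algebraically independent. -/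
theorem algebraicIndependent_of_isAlgebraic_adjoin {F E ι κ : Type*} [Field F] [Field E]
    [Algebra F E] [Finite ι] [Finite κ] {v : ι → E} {w : κ → E} (hw : AlgebraicIndependent F w)
    (hc : Nat.card ι ≤ Nat.card κ)
    (h : ∀ x : E, IsAlgebraic (IntermediateField.adjoin F (Set.range v)) x) :
    AlgebraicIndependent F v := by
  have : Algebra.IsAlgebraic (Algebra.adjoin F (Set.range v)) E := by
    rw [← IntermediateField.isAlgebraic_adjoin_iff_top]
    exact ⟨h⟩
  refine (Algebra.IsAlgebraic.isTranscendenceBasis_of_lift_le_trdeg_of_finite F v ?_).1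
  have := Fintype.ofFinite ι
  have := Fintype.ofFinite κ
  have h1 := hw.lift_cardinalMk_le_trdeg
  rw [Nat.card_eq_fintype_card, Nat.card_eq_fintype_card] at hc
  rw [Cardinal.mk_fintype, Cardinal.lift_natCast] at h1 ⊢
  rw [Cardinal.nat_le_lift_iff] at h1 ⊢
  exact (Nat.cast_le.2 hc).trans h1

end FieldTheory

/-! ### Finite groups acting on a ring -/

section Conj

variable {H A : Type*} [CommRing A]

/-- Two homomorphisms from `A` to a domain which agree on the elements of `A` fixed by a finite
group differ, on any finite family `v`, by an element of the group. The family is encoded in the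
single element `a = ∑ v k X_k` of a polynomial ring; `τ₁ a` is a root of `∏ (T - τ₂ (h a))`. The
hypotheses `hid` and `hact` say that `act` is an action, from the left or from the right. -/
theorem exists_apply_eq_apply_of_eqOn_fixed {Ω κ : Type*} [Finite H] [Finite κ] [CommRing Ω]
    [IsDomain Ω] (act : H → A →+* A) (hid : ∃ h, act h = RingHom.id A)
    (hact : ∀ g, ∃ e : Equiv.Perm H, ∀ h, (act g).comp (act h) = act (e h))
    (τ₁ τ₂ : A →+* Ω) (hτ : ∀ x, (∀ h, act h x = x) → τ₁ x = τ₂ x) (v : κ → A) :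
    ∃ h, ∀ k, τ₁ (v k) = τ₂ (act h (v k)) := by
  classical
  have := Fintype.ofFinite H
  have := Fintype.ofFinite κ
  let a : MvPolynomial κ A := ∑ k, MvPolynomial.C (v k) * MvPolynomial.X k
  have hcoeff : ∀ (θ : A →+* Ω) (k : κ),
      (MvPolynomial.map θ a).coeff (Finsupp.single k 1) = θ (v k) := by
    intro θ k
    rw [MvPolynomial.coeff_map]
    congr 1
    simp [a, MvPolynomial.coeff_sum, MvPolynomial.coeff_C_mul, MvPolynomial.coeff_X,
      Finsupp.single_left_inj]
  let p : Polynomial (MvPolynomial κ A) :=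
    ∏ h, (Polynomial.X - Polynomial.C (MvPolynomial.map (act h) a))
  have hp : ∀ θ : A →+* Ω, p.map (MvPolynomial.map θ)
      = ∏ h, (Polynomial.X - Polynomial.C (MvPolynomial.map (θ.comp (act h)) a)) := by
    intro θ
    simp [p, Polynomial.map_prod, MvPolynomial.map_map]
  have hfix : ∀ g, p.map (MvPolynomial.map (act g)) = p := by
    intro g
    obtain ⟨e, he⟩ := hact g
    simp only [p, Polynomial.map_prod, Polynomial.map_sub, Polynomial.map_X, Polynomial.map_C,
      MvPolynomial.map_map, he]
    exact Equiv.prod_comp e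
      fun h => Polynomial.X - Polynomial.C (MvPolynomial.map (act h) a)
  have heq : p.map (MvPolynomial.map τ₁) = p.map (MvPolynomial.map τ₂) := by
    ext m d
    simp only [Polynomial.coeff_map, MvPolynomial.coeff_map]
    apply hτ
    intro g
    conv_rhs => rw [← hfix g]
    simp only [Polynomial.coeff_map, MvPolynomial.coeff_map]
  have hroot : (p.map (MvPolynomial.map τ₁)).eval (MvPolynomial.map τ₁ a) = 0 := by
    obtain ⟨h, hh⟩ := hid
    rw [hp, Polynomial.eval_prod]
    apply Finset.prod_eq_zero (Finset.mem_univ h)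
    simp [hh]
  rw [heq, hp, Polynomial.eval_prod, Finset.prod_eq_zero_iff] at hroot
  obtain ⟨h, -, hh⟩ := hroot
  refine ⟨h, fun k => ?_⟩
  have := congrArg (MvPolynomial.coeff (Finsupp.single k 1))
    (sub_eq_zero.1 (by simpa using hh))
  rwa [hcoeff, hcoeff] at this

/-- Let a finite group act on a ring `A` which embeds into `E`. If the fixed elements are mapped
into `S`, then every element of `A` becomes separable over `S`: the product of the `T - c`, over
the distinct conjugates `c`, has fixed coefficients. -/
theorem isSeparable_of_fixed_mem {S E : Type*} [Finite H] [Field S] [Field E] [Algebra S E]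
    (act : H → A →+* A) (hid : ∃ h, act h = RingHom.id A)
    (hact : ∀ g, ∃ e : Equiv.Perm H, ∀ h, (act g).comp (act h) = act (e h))
    (θ : A →+* E) (hinj : Function.Injective θ)
    (hθ : ∀ x, (∀ h, act h x = x) → θ x ∈ (algebraMap S E).range) (a : A) :
    IsSeparable S (θ a) := by
  classical
  have := Fintype.ofFinite H
  let s : Finset A := Finset.univ.image fun h => act h a
  let p : Polynomial A := ∏ c ∈ s, (Polynomial.X - Polynomial.C c)
  -- Only the distinct conjugates are used, so that `p` is separable.
  have hs : ∀ g, s.image (act g) = s := by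
    intro g
    obtain ⟨e, he⟩ := hact g
    ext c
    simp only [s, Finset.mem_image, Finset.mem_univ, true_and, exists_exists_eq_and]
    constructor
    · rintro ⟨h, rfl⟩
      exact ⟨e h, by rw [← he]; rfl⟩
    · rintro ⟨h, rfl⟩
      refine ⟨e.symm h, ?_⟩
      rw [← RingHom.comp_apply, he, e.apply_symm_apply]
  have hinj' : ∀ g, Set.InjOn (act g) s := fun g =>
    Finset.injOn_of_card_image_eq (by rw [hs])
  have hfix : ∀ g, p.map (act g) = p := by
    intro g
    conv_rhs => rw [show p = ∏ c ∈ s.image (act g), (Polynomial.X - Polynomial.C c) by rw [hs]]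
    rw [Finset.prod_image (hinj' g)]
    simp [p, Polynomial.map_prod]
  have hpθ : p.map θ = ∏ c ∈ s, (Polynomial.X - Polynomial.C (θ c)) := by
    simp [p, Polynomial.map_prod]
  have hlift : p.map θ ∈ Polynomial.lifts (algebraMap S E) := by
    rw [Polynomial.lifts_iff_coeff_lifts]
    intro m
    rw [Polynomial.coeff_map]
    apply hθ
    intro g
    conv_rhs => rw [← hfix g]
    rw [Polynomial.coeff_map]
  obtain ⟨q, hq⟩ := (Polynomial.mem_lifts _).1 hlift
  have hsep : q.Separable := by
    rw [← Polynomial.separable_map (algebraMap S E), hq, hpθ]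
    exact Polynomial.separable_prod_X_sub_C_iff'.2 fun x _ y _ h => hinj h
  have hroot : Polynomial.aeval (θ a) q = 0 := by
    rw [Polynomial.aeval_def, ← Polynomial.eval_map, hq, hpθ, Polynomial.eval_prod]
    obtain ⟨h, hh⟩ := hid
    exact Finset.prod_eq_zero (i := a) (Finset.mem_image.2 ⟨h, Finset.mem_univ _, by simp [hh]⟩)
      (by simp)
  exact hsep.of_dvd (minpoly.dvd S _ hroot)

end Conj

/-! ### Additive polynomials -/

section Additive

/-- The polynomial `∏ (T + u)`, over the elements `u` of a finite additive group, is additive: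
`P(T + b) - P(T) - P(b)` has smaller degree than `P` and vanishes at all `u`. -/
theorem prod_add_add {M A : Type*} [AddCommGroup M] [Fintype M] [CommRing A] [IsDomain A]
    (j : M → A) (hadd : ∀ u v, j (u + v) = j u + j v)
    (hj : Function.Injective j) (a b : A) :
    ∏ u, (a + b + j u) = ∏ u, (a + j u) + ∏ u, (b + j u) := by
  classical
  let p : Polynomial A := ∏ u, (Polynomial.X + Polynomial.C (j u))
  have hp : p.Monic := Polynomial.monic_prod_of_monic _ _ fun u _ => Polynomial.monic_X_add_C _
  have hpe : ∀ c, p.eval c = ∏ u, (c + j u) := fun c => by simp [p, Polynomial.eval_prod]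
  have hdeg : p.natDegree = Fintype.card M := by
    simp [p, Polynomial.natDegree_prod_of_monic _ _ fun u _ => Polynomial.monic_X_add_C (j u)]
  have hinv : ∀ c v, p.eval (c + j v) = p.eval c := by
    intro c v
    rw [hpe, hpe, ← Equiv.prod_comp (Equiv.addLeft v) fun u => c + j u]
    simp [add_assoc, hadd]
  have h0 : j 0 = 0 := by simpa using hadd 0 0
  have hz : p.eval 0 = 0 := by
    rw [hpe]
    exact Finset.prod_eq_zero (Finset.mem_univ 0) (by simp [h0])
  have hpos : 0 < p.natDegree := by rw [hdeg]; exact Fintype.card_pos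
  let q : Polynomial A := (p.comp (Polynomial.X + Polynomial.C b) - p) - Polynomial.C (p.eval b)
  have hmon : (p.comp (Polynomial.X + Polynomial.C b)).Monic := hp.comp_X_add_C b
  have hnd : (p.comp (Polynomial.X + Polynomial.C b)).natDegree = p.natDegree := by
    simp [Polynomial.natDegree_comp]
  have hqdeg : q.degree < Fintype.card M := by
    refine (Polynomial.degree_sub_le _ _).trans_lt (max_lt ?_ ?_)
    · refine (Polynomial.degree_sub_lt_left ?_ hmon.ne_zero ?_).trans_eq ?_
      · rw [Polynomial.degree_eq_natDegree hmon.ne_zero, hnd,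
          ← Polynomial.degree_eq_natDegree hp.ne_zero]
      · rw [hmon.leadingCoeff, hp.leadingCoeff]
      · rw [Polynomial.degree_eq_natDegree hmon.ne_zero, hnd, hdeg]
    · refine Polynomial.degree_C_le.trans_lt ?_
      exact_mod_cast hdeg ▸ hpos
  have hq : q = 0 := by
    refine Polynomial.eq_zero_of_degree_lt_of_eval_index_eq_zero (s := Finset.univ) (v := j)
      hj.injOn (by simpa using hqdeg) fun u _ => ?_
    simp only [q, Polynomial.eval_sub, Polynomial.eval_comp, Polynomial.eval_add,
      Polynomial.eval_X, Polynomial.eval_C]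
    rw [add_comm, hinv, ← zero_add (j u), hinv, hz]
    ring
  have := congrArg (Polynomial.eval a) hq
  simp only [q, Polynomial.eval_sub, Polynomial.eval_comp, Polynomial.eval_add,
      Polynomial.eval_X, Polynomial.eval_C, Polynomial.eval_zero, hpe] at this
  linear_combination this

/-- The polynomial `∏ (T + u)`, over the elements `u` of a finite vector space over a finite field,
commutes with scalars. -/
theorem prod_smul_add {F M A : Type*} [Field F] [Finite F] [AddCommGroup M] [Module F M]
    [Fintype M] [CommRing A] [Algebra F A] (j : M → A)
    (hsmul : ∀ (c : F) (u : M), j (c • u) = c • j u) (c : F) (a : A) :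
    ∏ u, (c • a + j u) = c • ∏ u, (a + j u) := by
  have := Fintype.ofFinite F
  rcases eq_or_ne c 0 with rfl | hc
  · rw [zero_smul, zero_smul]
    exact Finset.prod_eq_zero (Finset.mem_univ 0) (by simpa using hsmul 0 0)
  · have h : ∀ u, c • a + j (c • u) = c • (a + j u) := by simp [hsmul]
    rw [← Equiv.prod_comp (LinearEquiv.smulOfNeZero F M c hc).toEquiv]
    change ∏ u, (c • a + j (c • u)) = _
    simp only [h]
    rw [Finset.prod_smul, Finset.prod_const, Finset.card_univ,
      Module.card_eq_pow_finrank (K := F) (V := M), FiniteField.pow_card_pow]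

end Additive

/-! ### Separable extensions and embeddings -/

section Separability

theorem mem_separableClosure_of_isSeparable {K E : Type*} [Field K] [Field E] [Algebra K E] {x : E}
    (hx : IsSeparable (separableClosure K E) x) : x ∈ separableClosure K E := by
  have h := mem_separableClosure_iff.2 hx
  rw [separableClosure.separableClosure_eq_bot] at h
  obtain ⟨y, rfl⟩ := IntermediateField.mem_bot.1 h
  exact y.2

/-- `x` is a root of `P(T) - P(x) = P(T - x)`, where `P(T) = ∏ (T + u)` is additive. -/
theorem isSeparable_of_prod_add_mem {M S E : Type*} [AddCommGroup M] [Fintype M] [Field S]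
    [Field E] [Algebra S E] (j : M → E) (hadd : ∀ u v, j (u + v) = j u + j v)
    (hj : Function.Injective j) (hjS : ∀ u, j u ∈ (algebraMap S E).range) {x : E}
    (hx : ∏ u, (x + j u) ∈ (algebraMap S E).range) : IsSeparable S x := by
  choose j' hj' using hjS
  obtain ⟨c, hc⟩ := hx
  let q : Polynomial S := ∏ u, (Polynomial.X + Polynomial.C (j' u)) - Polynomial.C c
  have hq : q.map (algebraMap S E) = ∏ u, (Polynomial.X - Polynomial.C (x - j u)) := by
    have h := prod_add_add (fun u => (Polynomial.C (j u) : Polynomial E))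
      (fun u v => by rw [hadd, map_add]) (Polynomial.C_injective.comp hj)
      (Polynomial.X - Polynomial.C x) (Polynomial.C x)
    have h1 : ∀ u, Polynomial.X - Polynomial.C (x - j u)
        = Polynomial.X - Polynomial.C x + Polynomial.C (j u) := fun u => by
      rw [map_sub]; ring
    have h2 : ∏ u, (Polynomial.C x + Polynomial.C (j u))
        = (Polynomial.C (algebraMap S E c) : Polynomial E) := by
      rw [hc, map_prod]
      simp only [map_add]
    simp only [h1]
    simp only [sub_add_cancel, h2] at h
    simp only [q, Polynomial.map_sub, Polynomial.map_prod, Polynomial.map_add, Polynomial.map_X,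
      Polynomial.map_C, hj', h, add_sub_cancel_right]
  have hsep : q.Separable := by
    rw [← Polynomial.separable_map (algebraMap S E), hq]
    exact Polynomial.separable_prod_X_sub_C_iff.2 fun u v h => hj (sub_right_injective h)
  have h0 : j 0 = 0 := by simpa using hadd 0 0
  have hroot : Polynomial.aeval x q = 0 := by
    rw [Polynomial.aeval_def, ← Polynomial.eval_map, hq, Polynomial.eval_prod]
    exact Finset.prod_eq_zero (Finset.mem_univ 0) (by simp [h0])
  exact hsep.of_dvd (minpoly.dvd S _ hroot)

/-- In a separable extension, an element on which all embeddings agree with the inclusion lies in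
the base field. -/
theorem mem_of_forall_algHom_eq {F E : Type*} [Field F] [Field E] [Algebra F E]
    (K : IntermediateField F E) [Algebra.IsSeparable K E] {x : E}
    (h : ∀ σ : E →ₐ[K] AlgebraicClosure E, σ x = algebraMap E (AlgebraicClosure E) x) :
    x ∈ K := by
  have hsep : (minpoly K x).Separable := Algebra.IsSeparable.isSeparable K x
  have h1 := Algebra.IsAlgebraic.range_eval_eq_rootSet_minpoly (F := K) (K := E)
    (AlgebraicClosure E) x
  have h2 := Polynomial.card_rootSet_eq_natDegree (K := AlgebraicClosure E) hsep
    (IsAlgClosed.splits _)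
  have h3 : Fintype.card ((minpoly K x).rootSet (AlgebraicClosure E)) ≤ 1 := by
    rw [Fintype.card_le_one_iff_subsingleton, Set.subsingleton_coe, ← h1]
    rintro _ ⟨σ, rfl⟩ _ ⟨τ, rfl⟩
    exact (h σ).trans (h τ).symm
  have h4 : (minpoly K x).natDegree = 1 :=
    le_antisymm (h2 ▸ h3) (minpoly.natDegree_pos (Algebra.IsIntegral.isIntegral x))
  obtain ⟨y, rfl⟩ := minpoly.natDegree_eq_one_iff.1 h4
  exact y.2

/-- The intermediate field on which two homomorphisms of fields agree. -/
def eqField {F K L : Type*} [Field F] [Field K] [Field L] [Algebra F K] [Algebra F L]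
    (σ τ : K →ₐ[F] L) : IntermediateField F K where
  __ := AlgHom.equalizer σ τ
  inv_mem' x hx := by
    have h : σ x = τ x := hx
    change σ x⁻¹ = τ x⁻¹
    rw [map_inv₀, map_inv₀, h]

theorem mem_eqField {F K L : Type*} [Field F] [Field K] [Field L] [Algebra F K] [Algebra F L]
    {σ τ : K →ₐ[F] L} {x : K} : x ∈ eqField σ τ ↔ σ x = τ x := Iff.rfl

end Separability

/-! ### Linear forms in the field of rational functions -/

section Forms

variable {F V V' : Type*} [Field F] [AddCommGroup V] [Module F V] [AddCommGroup V'] [Module F V']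

variable (F V) in
/-- The embedding of the linear forms on `V` into `F(V)`. -/
noncomputable def linForm : Dual F V →ₗ[F] RatField F V :=
  (IsScalarTower.toAlgHom F (PolyRing F V) (RatField F V)).toLinearMap ∘ₗ
    SymmetricAlgebra.ι F (Dual F V)

theorem linForm_apply (φ : Dual F V) :
    linForm F V φ = algebraMap (PolyRing F V) (RatField F V) (SymmetricAlgebra.ι F _ φ) := rfl

theorem symmetricAlgebra_ι_dual_injective :
    Function.Injective (SymmetricAlgebra.ι F (Dual F V)) := by
  rw [← LinearMap.ker_eq_bot, LinearMap.ker_eq_bot']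
  intro φ hφ
  ext v
  have h := congrArg (SymmetricAlgebra.lift (Dual.eval F V v)) hφ
  simpa using h

theorem linForm_injective : Function.Injective (linForm F V) :=
  (IsFractionRing.injective (PolyRing F V) (RatField F V)).comp symmetricAlgebra_ι_dual_injective

theorem ratField_algHom_ext {K : Type*} [Field K] [Algebra F K] {σ τ : RatField F V →ₐ[F] K}
    (h : ∀ φ, σ (linForm F V φ) = τ (linForm F V φ)) : σ = τ := by
  have h1 : σ.comp (IsScalarTower.toAlgHom F (PolyRing F V) (RatField F V))
      = τ.comp (IsScalarTower.toAlgHom F (PolyRing F V) (RatField F V)) := by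
    apply SymmetricAlgebra.algHom_ext
    ext φ
    exact h φ
  apply AlgHom.coe_ringHom_injective
  apply IsLocalization.ringHom_ext (nonZeroDivisors (PolyRing F V))
  apply RingHom.ext
  intro x
  exact AlgHom.congr_fun h1 x

theorem algebraMap_mem_adjoin_linForm (s : Set (Dual F V)) {f : PolyRing F V}
    (hf : f ∈ Algebra.adjoin F (SymmetricAlgebra.ι F (Dual F V) '' s)) :
    algebraMap (PolyRing F V) (RatField F V) f
      ∈ IntermediateField.adjoin F (linForm F V '' s) := by
  have h : Algebra.adjoin F (SymmetricAlgebra.ι F (Dual F V) '' s)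
      ≤ (IntermediateField.adjoin F (linForm F V '' s)).toSubalgebra.comap
        (IsScalarTower.toAlgHom F (PolyRing F V) (RatField F V)) := by
    rw [Algebra.adjoin_le_iff]
    rintro _ ⟨φ, hφ, rfl⟩
    exact IntermediateField.subset_adjoin F _ ⟨φ, hφ, rfl⟩
  exact h hf

theorem adjoin_range_linForm :
    IntermediateField.adjoin F (Set.range (linForm F V)) = ⊤ := by
  rw [eq_top_iff]
  intro x _
  obtain ⟨a, b, -, rfl⟩ := IsFractionRing.div_surjective (A := PolyRing F V) x
  have h : ∀ f : PolyRing F V, algebraMap (PolyRing F V) (RatField F V) f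
      ∈ IntermediateField.adjoin F (Set.range (linForm F V)) := by
    intro f
    rw [← Set.image_univ]
    apply algebraMap_mem_adjoin_linForm
    obtain ⟨x, rfl⟩ := SymmetricAlgebra.algHom_surjective F (Dual F V) f
    induction x using TensorAlgebra.induction with
    | algebraMap r => simp
    | ι φ => exact Algebra.subset_adjoin ⟨φ, trivial, rfl⟩
    | mul a b ha hb => rw [map_mul]; exact mul_mem ha hb
    | add a b ha hb => rw [map_add]; exact add_mem ha hb
  exact div_mem (h a) (h b)

theorem algebraicIndependent_linForm {κ : Type*} (b : Basis κ F (Dual F V)) :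
    AlgebraicIndependent F fun k => linForm F V (b k) := by
  have h : MvPolynomial.aeval (fun k => linForm F V (b k))
      = (IsScalarTower.toAlgHom F (PolyRing F V) (RatField F V)).comp
        (SymmetricAlgebra.equivMvPolynomial b).symm.toAlgHom := by
    apply MvPolynomial.algHom_ext
    intro k
    simp [linForm_apply]
  rw [AlgebraicIndependent, h]
  exact (IsFractionRing.injective (PolyRing F V) (RatField F V)).comp
    (SymmetricAlgebra.equivMvPolynomial b).symm.injective

theorem ratPullback_linForm (T : V →ₗ[F] V') (hT : Function.Surjective T) (φ : Dual F V') :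
    ratPullback T hT (linForm F V' φ) = linForm F V (φ ∘ₗ T) := by
  rw [linForm_apply, ratPullback_algebraMap, polyPullback_ι, linForm_apply]

theorem ratAct_linForm (g : V ≃ₗ[F] V) (φ : Dual F V) :
    ratAct g (linForm F V φ) = linForm F V (φ ∘ₗ g.toLinearMap) :=
  ratPullback_linForm _ _ _

theorem ratAct_one : ratAct (1 : V ≃ₗ[F] V) = AlgHom.id F _ :=
  ratField_algHom_ext fun φ => by
    rw [ratAct_linForm]
    rfl

theorem ratAct_mul (g h : V ≃ₗ[F] V) : ratAct (g * h) = (ratAct h).comp (ratAct g) :=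
  ratField_algHom_ext fun φ => by
    simp only [AlgHom.comp_apply, ratAct_linForm]
    rfl

end Forms

/-! ### Substitution of the orbit products -/

section Orbit

variable {F W : Type*} [Field F] [AddCommGroup W] [Module F W] {ℓ : ℕ}

variable (F W) in
/-- Linear forms on the first summand, in `F(W₁ ⊕ W₂)`. -/
noncomputable def fstForm : Dual F W →ₗ[F] RatField F (W × W) :=
  linForm F (W × W) ∘ₗ (LinearMap.fst F W W).dualMap

variable (F W) in
/-- Linear forms on the second summand, in `F(W₁ ⊕ W₂)`. -/
noncomputable def sndForm : Dual F W →ₗ[F] RatField F (W × W) :=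
  linForm F (W × W) ∘ₗ (LinearMap.snd F W W).dualMap

theorem sndForm_injective : Function.Injective (sndForm F W) :=
  linForm_injective.comp (LinearMap.dualMap_injective_of_surjective LinearMap.snd_surjective)

theorem linForm_prod (φ : Dual F (W × W)) : linForm F (W × W) φ
    = fstForm F W (φ ∘ₗ LinearMap.inl F W W) + sndForm F W (φ ∘ₗ LinearMap.inr F W W) := by
  simp only [fstForm, sndForm, LinearMap.comp_apply, ← map_add]
  congr 1
  ext w <;> simp [LinearMap.dualMap_apply', ← Prod.zero_eq_mk]

theorem ratPullback_snd_linForm (u : Dual F W) :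
    ratPullback (LinearMap.snd F W W) LinearMap.snd_surjective (linForm F W u) = sndForm F W u :=
  ratPullback_linForm _ _ _

variable (E : PartialFlag F W ℓ)

namespace PartialFlag

theorem orbitProd_eq_prod (i : Fin (ℓ + 1)) [Fintype (E.space i).dualAnnihilator] (y : Dual F W) :
    E.orbitProd i y = ∏ u : (E.space i).dualAnnihilator,
      (SymmetricAlgebra.ι F (Dual F (W × W)) (y ∘ₗ LinearMap.fst F W W)
      + SymmetricAlgebra.ι F (Dual F (W × W)) ((u : Dual F W) ∘ₗ LinearMap.snd F W W)) :=
  finprod_eq_prod_of_fintype _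

variable [Finite F] [FiniteDimensional F W]

instance finite_dual : Finite (Dual F W) := Module.finite_of_finite F

/-- The `F`-linear map `y ↦ N_{i+1}(y)` from linear forms on `W₁` to `F[V]`. -/
noncomputable def orbitMap (i : Fin (ℓ + 1)) : Dual F W →ₗ[F] PolyRing F (W × W) :=
  have := Fintype.ofFinite (E.space i).dualAnnihilator
  { toFun := E.orbitProd i
    map_add' := fun a b => by
      simp only [orbitProd_eq_prod, LinearMap.add_comp, map_add]
      refine prod_add_add (fun u : (E.space i).dualAnnihilator =>
        SymmetricAlgebra.ι F (Dual F (W × W)) ((u : Dual F W) ∘ₗ LinearMap.snd F W W)) ?_ ?_ _ _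
      · intro u v
        rw [← map_add]
        rfl
      · exact symmetricAlgebra_ι_dual_injective.comp
          ((LinearMap.dualMap_injective_of_surjective LinearMap.snd_surjective).comp
            Subtype.val_injective)
    map_smul' := fun c a => by
      simp only [orbitProd_eq_prod, LinearMap.smul_comp, map_smul]
      refine prod_smul_add (fun u : (E.space i).dualAnnihilator =>
        SymmetricAlgebra.ι F (Dual F (W × W)) ((u : Dual F W) ∘ₗ LinearMap.snd F W W)) ?_ _ _
      intro c u
      rw [← map_smul]
      rfl }

@[simp]
theorem orbitMap_apply (i : Fin (ℓ + 1)) (y : Dual F W) : E.orbitMap i y = E.orbitProd i y := rfl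

/-- The substitution of `N_{i+1}(y)` for all linear forms `y`, as a map `F[W₁] → F[V]`. -/
noncomputable def orbitAlgHom (i : Fin (ℓ + 1)) : PolyRing F W →ₐ[F] PolyRing F (W × W) :=
  SymmetricAlgebra.lift (E.orbitMap i)

theorem subst_eq_orbitAlgHom {n : ℕ} (y : Basis (Fin n) F (Dual F W)) (i : Fin (ℓ + 1))
    (f : PolyRing F W) : E.subst y i f = E.orbitAlgHom i f := by
  have h : (MvPolynomial.aeval fun k => E.orbitProd i (y k)).comp
      (SymmetricAlgebra.equivMvPolynomial y).toAlgHom = E.orbitAlgHom i := by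
    apply SymmetricAlgebra.algHom_ext
    apply y.ext
    intro k
    simp [orbitAlgHom]
  exact AlgHom.congr_fun h f

/-- Setting the variables of the second summand to zero turns `N_{i+1}` into a power of the
Frobenius map, which is injective. -/
theorem orbitAlgHom_injective (i : Fin (ℓ + 1)) : Function.Injective (E.orbitAlgHom i) := by
  have := Fintype.ofFinite F
  have := Fintype.ofFinite (E.space i).dualAnnihilator
  set d := finrank F (E.space i).dualAnnihilator
  have hpow : ∀ x, (FiniteField.frobeniusAlgHom F (PolyRing F W) ^ d) x
      = x ^ Fintype.card F ^ d := by
    intro x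
    rw [AlgHom.coe_pow, FiniteField.coe_frobeniusAlgHom, pow_iterate]
  have h : (polyPullback (LinearMap.inl F W W)).comp (E.orbitAlgHom i)
      = FiniteField.frobeniusAlgHom F (PolyRing F W) ^ d := by
    apply SymmetricAlgebra.algHom_ext
    ext y
    have h1 : ∀ u : Dual F W, (u ∘ₗ LinearMap.snd F W W) ∘ₗ LinearMap.inl F W W = 0 := by
      intro u; ext; simp
    have h2 : (y ∘ₗ LinearMap.fst F W W) ∘ₗ LinearMap.inl F W W = y := by
      ext; simp
    simp [orbitAlgHom, orbitProd_eq_prod, polyPullback_ι, h1, h2,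
      Module.card_eq_pow_finrank (K := F) (V := (E.space i).dualAnnihilator)]
    rw [← AlgHom.coe_pow, hpow]
  rw [injective_iff_map_eq_zero]
  intro x hx
  have h3 := AlgHom.congr_fun h x
  rw [AlgHom.comp_apply, hx, map_zero, hpow] at h3
  exact eq_zero_of_pow_eq_zero h3.symm

theorem algebraMap_comp_orbitAlgHom_injective (i : Fin (ℓ + 1)) : Function.Injective
    ((IsScalarTower.toAlgHom F (PolyRing F (W × W)) (RatField F (W × W))).comp
      (E.orbitAlgHom i)) :=
  (IsFractionRing.injective (PolyRing F (W × W)) (RatField F (W × W))).comp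
    (E.orbitAlgHom_injective i)

/-- The substitution of `N_{i+1}(y)` for all linear forms `y`, as an embedding of fields
`F(W₁) → F(V)`. -/
noncomputable def orbitHom (i : Fin (ℓ + 1)) : RatField F W →ₐ[F] RatField F (W × W) :=
  IsFractionRing.liftAlgHom (E.algebraMap_comp_orbitAlgHom_injective i)

theorem orbitHom_algebraMap (i : Fin (ℓ + 1)) (f : PolyRing F W) :
    E.orbitHom i (algebraMap _ _ f) = algebraMap _ _ (E.orbitAlgHom i f) :=
  IsFractionRing.lift_algebraMap (E.algebraMap_comp_orbitAlgHom_injective i) f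

theorem orbitHom_linForm (i : Fin (ℓ + 1)) [Fintype (E.space i).dualAnnihilator] (y : Dual F W) :
    E.orbitHom i (linForm F W y)
      = ∏ u : (E.space i).dualAnnihilator, (fstForm F W y + sndForm F W u) := by
  rw [linForm_apply, orbitHom_algebraMap, orbitAlgHom, SymmetricAlgebra.lift_ι_apply,
    orbitMap_apply, orbitProd_eq_prod, map_prod]
  simp only [map_add]
  rfl

theorem algebraMap_tilde {n : ℕ} (y : Basis (Fin n) F (Dual F W)) (f : Fin n → PolyRing F W)
    (j : Fin n) : algebraMap _ (RatField F (W × W)) (E.tilde y f j)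
      = E.orbitHom (E.level j) (algebraMap _ _ (f j)) := by
  rw [orbitHom_algebraMap, tilde, subst_eq_orbitAlgHom]

end PartialFlag

end Orbit

/-! ### Invariants of a finite group -/

section Action

variable {F V : Type*} [Field F] [AddCommGroup V] [Module F V] {G : Type*} [Group G]
  (ρ : G →* (V ≃ₗ[F] V))

/-- `g ↦ ratAct (ρ g)` is a right action: composing with `g` permutes the elements of the group. -/
theorem ratAct_comp_eq_perm (g : G) : ∃ e : Equiv.Perm G, ∀ h,
    (ratAct (ρ g)).toRingHom.comp (ratAct (ρ h)).toRingHom = (ratAct (ρ (e h))).toRingHom :=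
  ⟨Equiv.mulRight g, fun h => by
    rw [Equiv.coe_mulRight, map_mul, ratAct_mul]
    rfl⟩

theorem ratAct_map_one : (ratAct (ρ 1)).toRingHom = RingHom.id (RatField F V) := by
  rw [map_one, ratAct_one]
  rfl

/-- `F(V)` is separable over its field of invariants under a finite group. -/
theorem isSeparable_invariantField [Finite G] (x : RatField F V) :
    IsSeparable (invariantField ρ) x :=
  isSeparable_of_fixed_mem (fun g => (ratAct (ρ g)).toRingHom) ⟨1, ratAct_map_one ρ⟩
    (ratAct_comp_eq_perm ρ) (RingHom.id _) Function.injective_id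
    (fun x hx => ⟨⟨x, hx⟩, rfl⟩) x

end Action

/-! ### The subfields of the flag -/

section Flag

variable {F W : Type*} [Field F] [AddCommGroup W] [Module F W] {ℓ : ℕ}
  (E : PartialFlag F W ℓ)

namespace PartialFlag

theorem comp_mem_dualAnnihilator {i : Fin (ℓ + 1)} {u : Dual F W}
    (hu : u ∈ (E.space i).dualAnnihilator) {φ : W →ₗ[F] W} (hφ : φ ∈ E.endos) :
    u ∘ₗ φ ∈ (E.space i).dualAnnihilator := by
  rw [Submodule.mem_dualAnnihilator] at hu ⊢
  exact fun w hw => hu _ (hφ i w hw)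

theorem stdRep_mem_endos {G : Subgroup E.parabolic} (g : G) :
    (E.stdRep G g).toLinearMap ∈ E.endos :=
  E.parabolic_mem_endos g.1

/-- The subfield of `F(W)` generated by the linear forms which vanish on `F_i(W)`, that is,
the field `F(W / F_i(W))`. -/
noncomputable def levelField (i : Fin (ℓ + 1)) : IntermediateField F (RatField F W) :=
  IntermediateField.adjoin F (linForm F W '' ((E.space i).dualAnnihilator : Set (Dual F W)))

theorem linForm_mem_levelField {i : Fin (ℓ + 1)} {u : Dual F W}
    (hu : u ∈ (E.space i).dualAnnihilator) : linForm F W u ∈ E.levelField i :=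
  IntermediateField.subset_adjoin F _ ⟨u, hu, rfl⟩

theorem dualAnnihilator_anti {i j : Fin (ℓ + 1)} (h : i ≤ j) :
    (E.space j).dualAnnihilator ≤ (E.space i).dualAnnihilator :=
  Submodule.dualAnnihilator_anti (E.strictMono.monotone h)

theorem levelField_anti {i j : Fin (ℓ + 1)} (h : i ≤ j) : E.levelField j ≤ E.levelField i :=
  IntermediateField.adjoin.mono F _ _ (Set.image_mono (E.dualAnnihilator_anti h))

theorem levelField_le_iff {i : Fin (ℓ + 1)} {T : IntermediateField F (RatField F W)} :
    E.levelField i ≤ T ↔ ∀ u ∈ (E.space i).dualAnnihilator, linForm F W u ∈ T := by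
  rw [levelField, IntermediateField.adjoin_le_iff, Set.image_subset_iff]
  rfl

theorem ratAct_mem_levelField {G : Subgroup E.parabolic} (g : G) {i : Fin (ℓ + 1)}
    {x : RatField F W} (hx : x ∈ E.levelField i) :
    ratAct (E.stdRep G g) x ∈ E.levelField i := by
  have h : E.levelField i ≤ (E.levelField i).comap (ratAct (E.stdRep G g)) := by
    rw [levelField_le_iff]
    intro u hu
    change ratAct _ _ ∈ E.levelField i
    rw [ratAct_linForm]
    exact E.linForm_mem_levelField (E.comp_mem_dualAnnihilator hu (E.stdRep_mem_endos g))
  exact h hx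

theorem le_level {i : Fin (ℓ + 1)} {j : ℕ} (h : E.r i ≤ j) : i ≤ E.level j := by
  by_contra! hlt
  exact (E.lt_r_of_level_lt j i hlt).not_ge h

variable {n : ℕ} {y : Basis (Fin n) F (Dual F W)} {f : Fin n → PolyRing F W}
  {G₁ G₂ : Subgroup E.parabolic}

theorem BasisConsistent.mem_dualAnnihilator {E : PartialFlag F W ℓ} (hy : E.BasisConsistent y)
    {i : Fin (ℓ + 1)} {k : Fin n} (h : E.r i ≤ k) : y k ∈ (E.space i).dualAnnihilator := by
  rw [hy i]
  exact Submodule.subset_span ⟨k, h, rfl⟩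

theorem algebraMap_mem_levelField {E : PartialFlag F W ℓ} (hy : E.BasisConsistent y)
    (hf : E.SeqConsistent y f) (j : Fin n) :
    algebraMap _ (RatField F W) (f j) ∈ E.levelField (E.level j) := by
  apply algebraMap_mem_adjoin_linForm
  refine Algebra.adjoin_mono ?_ (hf j)
  rintro _ ⟨k, hk, rfl⟩
  exact ⟨y k, hy.mem_dualAnnihilator hk, rfl⟩

theorem levelField_le_adjoin_range {E : PartialFlag F W ℓ} (hy : E.BasisConsistent y)
    (i : Fin (ℓ + 1)) : E.levelField i ≤ IntermediateField.adjoin F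
      (Set.range fun k : {k : Fin n | E.r i ≤ k} => linForm F W (y k)) := by
  set T := IntermediateField.adjoin F
      (Set.range fun k : {k : Fin n | E.r i ≤ k} => linForm F W (y k))
  rw [levelField_le_iff, hy i]
  intro u hu
  have h : Submodule.span F {φ | ∃ k : Fin n, E.r i ≤ k ∧ φ = y k}
      ≤ (Subalgebra.toSubmodule T.toSubalgebra).comap (linForm F W) := by
    rw [Submodule.span_le]
    rintro _ ⟨k, hk, rfl⟩
    exact IntermediateField.subset_adjoin F _ ⟨⟨k, hk⟩, rfl⟩
  exact h hu

variable [Finite F] [FiniteDimensional F W]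

instance finite_parabolic : Finite E.parabolic :=
  have : Finite W := Module.finite_of_finite F
  have : Finite (W ≃ₗ[F] W) := Finite.of_injective _ DFunLike.coe_injective
  inferInstance

/-- `F(W)` has transcendence degree `n` and is algebraic over the invariants `F(f)`. -/
theorem algebraicIndependent_of_genField_eq (y : Basis (Fin n) F (Dual F W))
    (hgen : invariantField (E.stdRep G₁) = genField f) :
    AlgebraicIndependent F fun j => algebraMap _ (RatField F W) (f j) := by
  refine algebraicIndependent_of_isAlgebraic_adjoin (algebraicIndependent_linForm y) le_rfl ?_
  change ∀ x, IsAlgebraic (genField f) x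
  rw [← hgen]
  exact fun x => (isSeparable_invariantField (E.stdRep G₁) x).isIntegral.isAlgebraic

/-- An invariant which depends only on the forms vanishing on `F_i(W)` is a rational function of
the `f_k` which depend only on these forms. -/
theorem mem_adjoin_of_mem_levelField {E : PartialFlag F W ℓ} {G₁ : Subgroup E.parabolic}
    (hy : E.BasisConsistent y) (hf : E.SeqConsistent y f)
    (hgen : invariantField (E.stdRep G₁) = genField f) {i : Fin (ℓ + 1)} {x : RatField F W}
    (hx : x ∈ invariantField (E.stdRep G₁)) (hxi : x ∈ E.levelField i) :
    x ∈ IntermediateField.adjoin F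
      ((fun j => algebraMap _ (RatField F W) (f j)) '' {k : Fin n | E.r i ≤ k}) := by
  have hind := E.algebraicIndependent_of_genField_eq y hgen
  refine mem_adjoin_image_of_isAlgebraic hind _ (by rwa [hgen] at hx) ?_
  rw [Set.image_eq_range]
  refine isAlgebraic_adjoin_of_algebraicIndependent
    (v := fun k : {k : Fin n | E.r i ≤ k} => linForm F W (y k))
    (hind.comp _ Subtype.val_injective) ?_ (levelField_le_adjoin_range hy i hxi)
  exact fun k => levelField_le_adjoin_range hy i
    (E.levelField_anti (E.le_level k.2) (algebraMap_mem_levelField hy hf k))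

/-- The step of the descending inductions: the invariant `x` is a rational function of the `f_k`
with `r_i ≤ k`. If `level k = i`, then `N_{i+1}(f_k) = f̃_k`; otherwise `f_k` involves only forms
which vanish on `F_{i+1}(W)`. -/
theorem orbitHom_mem {E : PartialFlag F W ℓ} {G₁ : Subgroup E.parabolic}
    (hy : E.BasisConsistent y) (hf : E.SeqConsistent y f)
    (hgen : invariantField (E.stdRep G₁) = genField f)
    {T : IntermediateField F (RatField F (W × W))} (htilde : genField (E.tilde y f) ≤ T)
    (hsnd : ∀ u, sndForm F W u ∈ T) (i : Fin ℓ)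
    (hfst : ∀ u ∈ (E.space i.succ).dualAnnihilator, fstForm F W u ∈ T) {x : RatField F W}
    (hx : x ∈ invariantField (E.stdRep G₁)) (hxi : x ∈ E.levelField i.castSucc) :
    E.orbitHom i.castSucc x ∈ T := by
  have := Fintype.ofFinite (E.space i.castSucc).dualAnnihilator
  have h1 : E.levelField i.succ ≤ T.comap (E.orbitHom i.castSucc) := by
    rw [levelField_le_iff]
    intro u hu
    change E.orbitHom _ _ ∈ T
    rw [orbitHom_linForm]
    exact prod_mem fun v _ => add_mem (hfst u hu) (hsnd v)
  have h2 : IntermediateField.adjoin F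
      ((fun j => algebraMap _ (RatField F W) (f j)) '' {k : Fin n | E.r i.castSucc ≤ k})
      ≤ T.comap (E.orbitHom i.castSucc) := by
    rw [IntermediateField.adjoin_le_iff]
    rintro _ ⟨k, hk, rfl⟩
    rcases (E.le_level hk).eq_or_lt with h | h
    · change E.orbitHom _ _ ∈ T
      rw [h, ← algebraMap_tilde]
      exact htilde (IntermediateField.subset_adjoin F _ ⟨k, rfl⟩)
    · exact h1 (E.levelField_anti (Fin.castSucc_lt_iff_succ_le.1 h)
        (algebraMap_mem_levelField hy hf k))
  exact h2 (mem_adjoin_of_mem_levelField hy hf hgen hx hxi)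

end PartialFlag

end Flag

/-! ### The action of the gluing -/

section Gluing

variable {F W : Type*} [Field F] [AddCommGroup W] [Module F W] {ℓ : ℕ}
  {E : PartialFlag F W ℓ} {G₁ G₂ : Subgroup E.parabolic}

theorem ratAct_rep_fstForm (a : ParabolicGluing E G₁ G₂) (u : Dual F W) :
    ratAct (ParabolicGluing.rep a) (fstForm F W u)
      = fstForm F W (u ∘ₗ (E.stdRep G₁ a.left).toLinearMap)
        + sndForm F W (u ∘ₗ (a.mid : W →ₗ[F] W)) := by
  simp only [fstForm, sndForm, LinearMap.comp_apply, ratAct_linForm, ← map_add]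
  congr 1
  apply LinearMap.ext
  intro w
  exact map_add u _ _

theorem ratAct_rep_sndForm (a : ParabolicGluing E G₁ G₂) (u : Dual F W) :
    ratAct (ParabolicGluing.rep a) (sndForm F W u)
      = sndForm F W (u ∘ₗ (E.stdRep G₂ a.right).toLinearMap) := by
  simp only [sndForm, LinearMap.comp_apply, ratAct_linForm]
  rfl

theorem ratAct_rep_ratPullback (a : ParabolicGluing E G₁ G₂) (x : RatField F W) :
    ratAct (ParabolicGluing.rep a)
        (ratPullback (LinearMap.snd F W W) LinearMap.snd_surjective x)
      = ratPullback (LinearMap.snd F W W) LinearMap.snd_surjective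
        (ratAct (E.stdRep G₂ a.right) x) := by
  have h : (ratAct (ParabolicGluing.rep a)).comp
        (ratPullback (LinearMap.snd F W W) LinearMap.snd_surjective)
      = (ratPullback (LinearMap.snd F W W) LinearMap.snd_surjective).comp
        (ratAct (E.stdRep G₂ a.right)) :=
    ratField_algHom_ext fun u => by
      simp only [AlgHom.comp_apply, ratPullback_snd_linForm, ratAct_linForm, ratAct_rep_sndForm]
  exact AlgHom.congr_fun h x

variable [Finite F] [FiniteDimensional F W]

/-- On `F(W₁ / F_i(W₁))`, the embedding `N_{i+1}` intertwines `(g₁, φ, g₂)` with `g₁`: the factors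
of `N_{i+1}(u)` are permuted by `v ↦ u ∘ φ + v ∘ g₂`. -/
theorem ratAct_rep_orbitHom (a : ParabolicGluing E G₁ G₂) {i : Fin (ℓ + 1)} {x : RatField F W}
    (hx : x ∈ E.levelField i) :
    ratAct (ParabolicGluing.rep a) (E.orbitHom i x)
      = E.orbitHom i (ratAct (E.stdRep G₁ a.left) x) := by
  have := Fintype.ofFinite (E.space i).dualAnnihilator
  have h : E.levelField i ≤ eqField ((ratAct (ParabolicGluing.rep a)).comp (E.orbitHom i))
      ((E.orbitHom i).comp (ratAct (E.stdRep G₁ a.left))) := by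
    rw [PartialFlag.levelField_le_iff]
    intro u hu
    rw [mem_eqField, AlgHom.comp_apply, AlgHom.comp_apply, ratAct_linForm,
      PartialFlag.orbitHom_linForm, PartialFlag.orbitHom_linForm, map_prod]
    refine Fintype.prod_bijective
      (fun v : (E.space i).dualAnnihilator =>
        (⟨u ∘ₗ (a.mid : W →ₗ[F] W), E.comp_mem_dualAnnihilator hu a.mid.2⟩ +
        ⟨v ∘ₗ (E.stdRep G₂ a.right).toLinearMap,
          E.comp_mem_dualAnnihilator v.2 (E.stdRep_mem_endos a.right)⟩ :
          (E.space i).dualAnnihilator)) ?_ _ _ ?_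
    · rw [← Finite.injective_iff_bijective]
      intro v w hvw
      have h1 := congrArg Subtype.val (add_left_cancel hvw)
      exact Subtype.ext (LinearMap.cancel_right (E.stdRep G₂ a.right).surjective |>.1 h1)
    · intro v
      rw [map_add, ratAct_rep_fstForm, ratAct_rep_sndForm, Submodule.coe_add, map_add, add_assoc]
  exact h hx

/-- The generators of the proposed field are invariant. -/
theorem sup_le_invariantField {n : ℕ} {y : Basis (Fin n) F (Dual F W)} {f : Fin n → PolyRing F W}
    (hy : E.BasisConsistent y) (hf : E.SeqConsistent y f)
    (hgen : invariantField (E.stdRep G₁) = genField f) :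
    genField (E.tilde y f) ⊔ E.sndInvariantField G₂
      ≤ invariantField (ParabolicGluing.rep : ParabolicGluing E G₁ G₂ →* _) := by
  refine sup_le ?_ ?_
  · rw [genField, IntermediateField.adjoin_le_iff]
    rintro _ ⟨j, rfl⟩ a
    beta_reduce
    rw [E.algebraMap_tilde, ratAct_rep_orbitHom a (PartialFlag.algebraMap_mem_levelField hy hf j)]
    have h : algebraMap _ (RatField F W) (f j) ∈ invariantField (E.stdRep G₁) := by
      rw [hgen]
      exact IntermediateField.subset_adjoin F _ ⟨j, rfl⟩
    rw [h a.left]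
  · rintro _ ⟨x, hx, rfl⟩ a
    refine (ratAct_rep_ratPullback a x).trans ?_
    rw [hx a.right]
    rfl

end Gluing

/-! ### The action on the subfields of the flag -/

variable {F W : Type*} [Field F] [AddCommGroup W] [Module F W] {ℓ : ℕ}
  {E : PartialFlag F W ℓ} {G₁ G₂ : Subgroup E.parabolic}

namespace PartialFlag

theorem eq_zero_of_mem_dualAnnihilator_last {u : Dual F W}
    (hu : u ∈ (E.space (Fin.last ℓ)).dualAnnihilator) : u = 0 := by
  rwa [E.space_last, Submodule.dualAnnihilator_top, Submodule.mem_bot] at hu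

theorem stdRep_comp_inv (g : G₁) :
    (E.stdRep G₁ g).toLinearMap ∘ₗ (E.stdRep G₁ g⁻¹).toLinearMap = LinearMap.id := by
  have h : E.stdRep G₁ g * E.stdRep G₁ g⁻¹ = 1 := by rw [← map_mul, mul_inv_cancel, map_one]
  exact congrArg LinearEquiv.toLinearMap h

theorem stdRep_inv_comp (g : G₁) :
    (E.stdRep G₁ g⁻¹).toLinearMap ∘ₗ (E.stdRep G₁ g).toLinearMap = LinearMap.id := by
  have h : E.stdRep G₁ g⁻¹ * E.stdRep G₁ g = 1 := by rw [← map_mul, inv_mul_cancel, map_one]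
  exact congrArg LinearEquiv.toLinearMap h

theorem stdRep_one_toLinearMap : (E.stdRep G₁ 1).toLinearMap = LinearMap.id := by
  rw [map_one]
  rfl

/-- The right action of a subgroup of the parabolic subgroup on `F(W / F_i(W))`. -/
noncomputable def levelAct (G : Subgroup E.parabolic) (i : Fin (ℓ + 1)) (g : G) :
    E.levelField i →+* E.levelField i :=
  (ratAct (E.stdRep G g)).toRingHom.restrict _ _ fun _ hx => E.ratAct_mem_levelField g hx

theorem levelAct_one (i : Fin (ℓ + 1)) : levelAct G₁ i 1 = RingHom.id _ := by
  ext x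
  exact RingHom.congr_fun (ratAct_map_one (E.stdRep G₁)) x

theorem levelAct_comp_eq_perm (i : Fin (ℓ + 1)) (g : G₁) : ∃ e : Equiv.Perm G₁, ∀ h,
    (levelAct G₁ i g).comp (levelAct G₁ i h) = levelAct G₁ i (e h) := by
  obtain ⟨e, he⟩ := ratAct_comp_eq_perm (E.stdRep G₁) g
  refine ⟨e, fun h => ?_⟩
  ext x
  exact RingHom.congr_fun (he h) x

theorem mem_invariantField_of_levelAct {i : Fin (ℓ + 1)} {x : E.levelField i}
    (hx : ∀ g, levelAct G₁ i g x = x) : (x : RatField F W) ∈ invariantField (E.stdRep G₁) :=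
  fun g => congrArg Subtype.val (hx g)

end PartialFlag

/-! ### Embeddings over the proposed field of invariants -/

section Main

variable {n : ℕ} {y : Basis (Fin n) F (Dual F W)} {f : Fin n → PolyRing F W}
  [Finite F] [FiniteDimensional F W]

/-- `F(V)` is separable over the field generated by the `f̃_j` and `F(W₂)^{G₂}`. The forms on `W₂`
are separable over `F(W₂)^{G₂}`; by descending induction on `i`, the elements `N_{i+1}(u)` and then
the forms `u` on `W₁` which vanish on `F_i(W₁)` are separable. -/
theorem isSeparable_over_sup
    (hy : E.BasisConsistent y) (hf : E.SeqConsistent y f)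
    (hgen : invariantField (E.stdRep G₁) = genField f) :
    Algebra.IsSeparable (genField (E.tilde y f) ⊔ E.sndInvariantField G₂ :
      IntermediateField F (RatField F (W × W))) (RatField F (W × W)) := by
  set K := genField (E.tilde y f) ⊔ E.sndInvariantField G₂ with hK
  set S := (separableClosure K (RatField F (W × W))).restrictScalars F with hS
  have hKS : K ≤ S := fun x hx => (separableClosure K (RatField F (W × W))).algebraMap_mem ⟨x, hx⟩
  have hmem : ∀ x, IsSeparable (separableClosure K (RatField F (W × W))) x → x ∈ S :=
    fun x hx => mem_separableClosure_of_isSeparable hx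
  have hsnd : ∀ u, sndForm F W u ∈ S := by
    intro u
    rw [← ratPullback_snd_linForm]
    refine mem_separableClosure_iff.2 (isSeparable_of_fixed_mem
      (fun g => (ratAct (E.stdRep G₂ g)).toRingHom) ⟨1, ratAct_map_one _⟩
      (ratAct_comp_eq_perm _)
      (ratPullback (LinearMap.snd F W W) LinearMap.snd_surjective).toRingHom
      (RingHom.injective _) (fun x hx => ?_) (linForm F W u))
    exact ⟨⟨_, (le_sup_right : _ ≤ K) ⟨x, hx, rfl⟩⟩, rfl⟩
  have hfst : ∀ i, ∀ u ∈ (E.space i).dualAnnihilator, fstForm F W u ∈ S := by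
    intro i
    induction i using Fin.reverseInduction with
    | last =>
      intro u hu
      rw [PartialFlag.eq_zero_of_mem_dualAnnihilator_last hu, map_zero]
      exact zero_mem S
    | cast i ih =>
      intro u hu
      have := Fintype.ofFinite (E.space i.castSucc).dualAnnihilator
      have h1 : E.orbitHom i.castSucc (linForm F W u) ∈ S := by
        refine hmem _ (isSeparable_of_fixed_mem (PartialFlag.levelAct G₁ i.castSucc)
          ⟨1, PartialFlag.levelAct_one _⟩ (PartialFlag.levelAct_comp_eq_perm _)
          ((E.orbitHom i.castSucc).toRingHom.comp (E.levelField i.castSucc).val.toRingHom)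
          (RingHom.injective _) (fun x hx => ?_)
          ⟨linForm F W u, E.linForm_mem_levelField hu⟩)
        exact ⟨⟨_, PartialFlag.orbitHom_mem hy hf hgen (le_sup_left.trans hKS) hsnd i ih
          (PartialFlag.mem_invariantField_of_levelAct hx) x.2⟩, rfl⟩
      rw [PartialFlag.orbitHom_linForm] at h1
      refine hmem _ (isSeparable_of_prod_add_mem
        (fun v : (E.space i.castSucc).dualAnnihilator => sndForm F W v)
        (fun v w => by rw [Submodule.coe_add, map_add])
        (sndForm_injective.comp Subtype.val_injective) (fun v => ⟨⟨_, hsnd v⟩, rfl⟩)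
        ⟨⟨_, h1⟩, rfl⟩)
  rw [← separableClosure.eq_top_iff, eq_top_iff]
  have htop : (⊤ : IntermediateField F (RatField F (W × W))) ≤ S := by
    rw [← adjoin_range_linForm, IntermediateField.adjoin_le_iff]
    rintro _ ⟨φ, rfl⟩
    rw [linForm_prod]
    refine add_mem (hfst 0 _ ?_) (hsnd _)
    rw [E.space_zero, Submodule.dualAnnihilator_bot]
    trivial
  exact fun x _ => htop (IntermediateField.mem_top)

variable {L : Type*} [Field L] [Algebra F L] {σ τ : RatField F (W × W) →ₐ[F] L}

variable (G₁) in
/-- An element of `G₂` makes `σ` agree with `τ` on `F(W₂)`. -/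
theorem exists_right_correction (h : ∀ x ∈ E.sndInvariantField G₂, σ x = τ x) :
    ∃ a : ParabolicGluing E G₁ G₂, ∀ u,
      σ (ratAct (ParabolicGluing.rep a) (sndForm F W u)) = τ (sndForm F W u) := by
  let p := ratPullback (LinearMap.snd F W W) LinearMap.snd_surjective
  obtain ⟨g, hg⟩ := exists_apply_eq_apply_of_eqOn_fixed
    (fun g => (ratAct (E.stdRep G₂ g)).toRingHom) ⟨1, ratAct_map_one _⟩ (ratAct_comp_eq_perm _)
    (σ.comp p).toRingHom (τ.comp p).toRingHom (fun x hx => h _ ⟨x, hx, rfl⟩) (linForm F W)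
  have hg' : ∀ u, σ (sndForm F W u)
      = τ (sndForm F W (u ∘ₗ (E.stdRep G₂ g).toLinearMap)) := by
    intro u
    rw [← ratPullback_snd_linForm, ← ratPullback_snd_linForm, ← ratAct_linForm]
    exact hg u
  refine ⟨⟨1, 0, g⁻¹⟩, fun u => ?_⟩
  rw [ratAct_rep_sndForm, hg', LinearMap.comp_assoc, PartialFlag.stdRep_inv_comp,
    LinearMap.comp_id]

/-- An element of `G₁` makes `σ` agree with `τ` on `N_{i+1}(u)` for `u` vanishing on `F_i(W₁)`. It
fixes the forms vanishing on `F_{i+1}(W₁)`, because there `σ` and `τ` agree already. -/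
theorem exists_left_correction (hy : E.BasisConsistent y) (hf : E.SeqConsistent y f)
    (hgen : invariantField (E.stdRep G₁) = genField f)
    (htilde : ∀ x ∈ genField (E.tilde y f), σ x = τ x)
    (hsnd : ∀ u, σ (sndForm F W u) = τ (sndForm F W u)) (i : Fin ℓ)
    (hfst : ∀ u ∈ (E.space i.succ).dualAnnihilator, σ (fstForm F W u) = τ (fstForm F W u)) :
    ∃ a : ParabolicGluing E G₁ G₂,
      (∀ u, σ (ratAct (ParabolicGluing.rep a) (sndForm F W u)) = τ (sndForm F W u)) ∧
      (∀ u ∈ (E.space i.succ).dualAnnihilator,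
        σ (ratAct (ParabolicGluing.rep a) (fstForm F W u)) = τ (fstForm F W u)) ∧
      ∀ u ∈ (E.space i.castSucc).dualAnnihilator,
        σ (ratAct (ParabolicGluing.rep a) (E.orbitHom i.castSucc (linForm F W u)))
          = τ (E.orbitHom i.castSucc (linForm F W u)) := by
  have := Fintype.ofFinite (E.space i.castSucc).dualAnnihilator
  let p := (E.orbitHom i.castSucc).comp (E.levelField i.castSucc).val
  obtain ⟨g, hg⟩ := exists_apply_eq_apply_of_eqOn_fixed
    (PartialFlag.levelAct G₁ i.castSucc)
    ⟨1, PartialFlag.levelAct_one _⟩ (PartialFlag.levelAct_comp_eq_perm _)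
    (σ.comp p).toRingHom (τ.comp p).toRingHom
    (fun x hx => PartialFlag.orbitHom_mem (T := eqField σ τ) hy hf hgen htilde hsnd i hfst
      (PartialFlag.mem_invariantField_of_levelAct hx) x.2)
    (fun u : (E.space i.castSucc).dualAnnihilator =>
      (⟨linForm F W u, E.linForm_mem_levelField u.2⟩ : E.levelField i.castSucc))
  have hg' : ∀ u ∈ (E.space i.castSucc).dualAnnihilator,
      σ (E.orbitHom i.castSucc (linForm F W u))
      = τ (E.orbitHom i.castSucc (linForm F W (u ∘ₗ (E.stdRep G₁ g).toLinearMap))) := by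
    intro u hu
    rw [← ratAct_linForm]
    exact hg ⟨u, hu⟩
  have hfix : ∀ u ∈ (E.space i.succ).dualAnnihilator,
      u ∘ₗ (E.stdRep G₁ g).toLinearMap = u := by
    intro u hu
    have h1 : σ (E.orbitHom i.castSucc (linForm F W u))
        = τ (E.orbitHom i.castSucc (linForm F W u)) := by
      rw [PartialFlag.orbitHom_linForm, map_prod, map_prod]
      simp only [map_add, hfst u hu, hsnd]
    rw [hg' u (E.dualAnnihilator_anti i.castSucc_lt_succ.le hu)] at h1
    exact linForm_injective ((E.orbitHom _).injective (τ.injective h1))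
  refine ⟨⟨g⁻¹, 0, 1⟩, fun u => ?_, fun u hu => ?_, fun u hu => ?_⟩
  · rw [ratAct_rep_sndForm, PartialFlag.stdRep_one_toLinearMap, LinearMap.comp_id, hsnd]
  · have h1 : u ∘ₗ (E.stdRep G₁ g⁻¹).toLinearMap = u := by
      conv_lhs => rw [← hfix u hu]
      rw [LinearMap.comp_assoc, PartialFlag.stdRep_comp_inv, LinearMap.comp_id]
    rw [ratAct_rep_fstForm, h1, Submodule.coe_zero, LinearMap.comp_zero, map_zero, add_zero,
      hfst u hu]
  · rw [ratAct_rep_orbitHom _ (E.linForm_mem_levelField hu), ratAct_linForm,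
      hg' _ (E.comp_mem_dualAnnihilator hu (E.stdRep_mem_endos _)), LinearMap.comp_assoc,
      PartialFlag.stdRep_inv_comp, LinearMap.comp_id]

omit [Finite F] in
/-- There is an element `φ` of `M_F` for which the forms `y_k ∘ φ` with `k < r_{i+1}` are
prescribed elements of the annihilator of `F_i(W)`, and the others are `0`. It is the transpose of
an endomorphism of the dual space which maps every annihilator to itself. -/
theorem exists_endos_comp_eq (hy : E.BasisConsistent y) (i : Fin ℓ)
    (v : Fin n → (E.space i.castSucc).dualAnnihilator) : ∃ φ ∈ E.endos,
      ∀ k, y k ∘ₗ φ = if (k : ℕ) < E.r i.succ then (v k : Dual F W) else 0 := by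
  let D : Dual F W →ₗ[F] Dual F W :=
    y.constr F fun k => if (k : ℕ) < E.r i.succ then (v k : Dual F W) else 0
  have hD : ∀ k, D (y k) = if (k : ℕ) < E.r i.succ then (v k : Dual F W) else 0 :=
    fun k => y.constr_basis F _ k
  let φ : W →ₗ[F] W :=
    (evalEquiv F W).symm.toLinearMap ∘ₗ D.dualMap ∘ₗ (evalEquiv F W).toLinearMap
  have hφ : ∀ u : Dual F W, u ∘ₗ φ = D u := by
    intro u
    ext w
    simp [φ]
  refine ⟨φ, fun m w hw => ?_, fun k => by rw [hφ, hD]⟩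
  rw [← Subspace.forall_mem_dualAnnihilator_apply_eq_zero_iff]
  intro u hu
  have h1 : (E.space m).dualAnnihilator ≤ (E.space m).dualAnnihilator.comap D := by
    conv_lhs => rw [hy m]
    rw [Submodule.span_le]
    rintro _ ⟨k, hk, rfl⟩
    change D (y k) ∈ (E.space m).dualAnnihilator
    rw [hD]
    split_ifs with hlt
    · refine E.dualAnnihilator_anti ?_ (v k).2
      by_contra! hm
      have h2 : E.r i.succ ≤ E.r m :=
        Submodule.finrank_mono (E.strictMono.monotone (Fin.castSucc_lt_iff_succ_le.1 hm))
      omega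
    · exact zero_mem _
  have h3 := (Submodule.mem_dualAnnihilator _).1 (h1 hu) w hw
  rwa [← hφ] at h3

/-- An element `(1, φ, 1)` makes `σ` agree with `τ` on the forms vanishing on `F_i(W₁)`, if they
agree on the `N_{i+1}(u)`: then `σ u - τ u` is a root of the additive polynomial `N_{i+1}`, hence
the image of a form on `W₂` vanishing on `F_i(W₂)`. -/
theorem exists_mid_correction (hy : E.BasisConsistent y)
    (hsnd : ∀ u, σ (sndForm F W u) = τ (sndForm F W u)) (i : Fin ℓ)
    (hfst : ∀ u ∈ (E.space i.succ).dualAnnihilator, σ (fstForm F W u) = τ (fstForm F W u))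
    (horb : ∀ u ∈ (E.space i.castSucc).dualAnnihilator,
        σ (E.orbitHom i.castSucc (linForm F W u)) = τ (E.orbitHom i.castSucc (linForm F W u))) :
    ∃ a : ParabolicGluing E G₁ G₂,
      (∀ u, σ (ratAct (ParabolicGluing.rep a) (sndForm F W u)) = τ (sndForm F W u)) ∧
      ∀ u ∈ (E.space i.castSucc).dualAnnihilator,
        σ (ratAct (ParabolicGluing.rep a) (fstForm F W u)) = τ (fstForm F W u) := by
  have := Fintype.ofFinite (E.space i.castSucc).dualAnnihilator
  have hex : ∀ u ∈ (E.space i.castSucc).dualAnnihilator,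
      ∃ v : (E.space i.castSucc).dualAnnihilator,
        σ (fstForm F W u) + τ (sndForm F W v) = τ (fstForm F W u) := by
    intro u hu
    have h1 := horb u hu
    simp only [PartialFlag.orbitHom_linForm, map_prod, map_add, hsnd] at h1
    have h2 := prod_add_add
      (fun v : (E.space i.castSucc).dualAnnihilator => τ (sndForm F W v))
      (fun v w => by rw [Submodule.coe_add, map_add, map_add])
      (τ.injective.comp (sndForm_injective.comp Subtype.val_injective))
      (σ (fstForm F W u) - τ (fstForm F W u)) (τ (fstForm F W u))
    rw [sub_add_cancel, h1, right_eq_add, Finset.prod_eq_zero_iff] at h2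
    obtain ⟨v, -, hv⟩ := h2
    exact ⟨v, by linear_combination hv⟩
  -- The condition `r_i ≤ k` is moved inside, to have a `v k` for every `k`; those with `k < r_i`
  -- play no role.
  have hex' : ∀ k : Fin n, ∃ v : (E.space i.castSucc).dualAnnihilator,
      E.r i.castSucc ≤ k → σ (fstForm F W (y k)) + τ (sndForm F W v) = τ (fstForm F W (y k)) := by
    intro k
    by_cases hk : E.r i.castSucc ≤ k
    · obtain ⟨v, hv⟩ := hex _ (hy.mem_dualAnnihilator hk)
      exact ⟨v, fun _ => hv⟩
    · exact ⟨0, fun h => absurd h hk⟩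
  choose v hv using hex'
  obtain ⟨φ, hφ, hφy⟩ := exists_endos_comp_eq hy i v
  refine ⟨⟨1, ⟨φ, hφ⟩, 1⟩, fun u => ?_, fun u hu => ?_⟩
  · rw [ratAct_rep_sndForm, PartialFlag.stdRep_one_toLinearMap, LinearMap.comp_id, hsnd]
  · rw [hy] at hu
    induction hu using Submodule.span_induction with
    | mem u hu =>
      obtain ⟨k, hk, rfl⟩ := hu
      rw [ratAct_rep_fstForm, PartialFlag.stdRep_one_toLinearMap, LinearMap.comp_id, map_add,
        hsnd, hφy]
      split_ifs with hlt
      · exact hv k hk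
      · rw [map_zero, map_zero, add_zero, hfst _ (hy.mem_dualAnnihilator (not_lt.1 hlt))]
    | zero => simp only [map_zero]
    | add u v _ _ hu hv => simp only [map_add, hu, hv]
    | smul c u _ hu => simp only [map_smul, hu]

/-- Two embeddings of `F(V)` which agree on the `f̃_j` and on `F(W₂)^{G₂}` differ by an element of
the gluing. -/
theorem exists_comp_ratAct_eq (hy : E.BasisConsistent y) (hf : E.SeqConsistent y f)
    (hgen : invariantField (E.stdRep G₁) = genField f)
    (h : ∀ x ∈ genField (E.tilde y f) ⊔ E.sndInvariantField G₂, σ x = τ x) :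
    ∃ a : ParabolicGluing E G₁ G₂, σ.comp (ratAct (ParabolicGluing.rep a)) = τ := by
  have hcomp : ∀ (a b : ParabolicGluing E G₁ G₂) x, ratAct (ParabolicGluing.rep (b * a)) x
      = ratAct (ParabolicGluing.rep a) (ratAct (ParabolicGluing.rep b) x) := by
    intro a b x
    rw [map_mul, ratAct_mul, AlgHom.comp_apply]
  have key : ∀ i, ∃ a : ParabolicGluing E G₁ G₂,
      (∀ u, σ (ratAct (ParabolicGluing.rep a) (sndForm F W u)) = τ (sndForm F W u)) ∧
      ∀ u ∈ (E.space i).dualAnnihilator,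
        σ (ratAct (ParabolicGluing.rep a) (fstForm F W u)) = τ (fstForm F W u) := by
    intro i
    induction i using Fin.reverseInduction with
    | last =>
      obtain ⟨a, ha⟩ := exists_right_correction G₁
        fun x hx => h x ((le_sup_right : E.sndInvariantField G₂ ≤ _) hx)
      refine ⟨a, ha, fun u hu => ?_⟩
      simp only [PartialFlag.eq_zero_of_mem_dualAnnihilator_last hu, map_zero]
    | cast i ih =>
      obtain ⟨a, ha₁, ha₂⟩ := ih
      obtain ⟨b, hb₁, hb₂, hb₃⟩ := exists_left_correction (G₂ := G₂)
        (σ := σ.comp (ratAct (ParabolicGluing.rep a))) hy hf hgen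
        (fun x hx => by
          have hx' := (le_sup_left : _ ≤ genField (E.tilde y f) ⊔ E.sndInvariantField G₂) hx
          rw [AlgHom.comp_apply, sup_le_invariantField hy hf hgen hx' a, h x hx'])
        ha₁ i ha₂
      obtain ⟨c, hc₁, hc₂⟩ := exists_mid_correction (G₁ := G₁) (G₂ := G₂)
        (σ := (σ.comp (ratAct (ParabolicGluing.rep a))).comp (ratAct (ParabolicGluing.rep b)))
        hy hb₁ i hb₂ hb₃
      refine ⟨c * (b * a), fun u => ?_, fun u hu => ?_⟩
      · rw [hcomp, hcomp]
        exact hc₁ u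
      · rw [hcomp, hcomp]
        exact hc₂ u hu
  obtain ⟨a, ha₁, ha₂⟩ := key 0
  refine ⟨a, ratField_algHom_ext fun φ => ?_⟩
  rw [linForm_prod, map_add, map_add, AlgHom.comp_apply, AlgHom.comp_apply, ha₁, ha₂]
  rw [E.space_zero, Submodule.dualAnnihilator_bot]
  trivial

theorem invariantField_le_sup (hy : E.BasisConsistent y) (hf : E.SeqConsistent y f)
    (hgen : invariantField (E.stdRep G₁) = genField f) :
    invariantField (ParabolicGluing.rep : ParabolicGluing E G₁ G₂ →* _)
      ≤ genField (E.tilde y f) ⊔ E.sndInvariantField G₂ := by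
  intro x hx
  have := isSeparable_over_sup (G₂ := G₂) hy hf hgen
  refine mem_of_forall_algHom_eq _ fun σ => ?_
  obtain ⟨a, ha⟩ := exists_comp_ratAct_eq (G₂ := G₂) hy hf hgen
    (σ := σ.restrictScalars F)
    (τ := IsScalarTower.toAlgHom F (RatField F (W × W)) (AlgebraicClosure (RatField F (W × W))))
    (fun z hz => σ.commutes ⟨z, hz⟩)
  have h1 := AlgHom.congr_fun ha x
  rw [AlgHom.comp_apply, hx a] at h1
  exact h1

theorem linearDisjoint_tilde (hy : E.BasisConsistent y) (hf : E.SeqConsistent y f)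
    (hgen : invariantField (E.stdRep G₁) = genField f) :
    (genField (E.tilde y f)).LinearDisjoint (E.sndInvariantField G₂) := by
  let t : Fin n → RatField F (W × W) := fun j => algebraMap _ _ (E.tilde y f j)
  let w : Fin n → RatField F (W × W) := fun k => sndForm F W (y k)
  have hw : E.sndInvariantField G₂ ≤ IntermediateField.adjoin F (Set.range w) := by
    have h1 : ⊤ ≤ (IntermediateField.adjoin F (Set.range w)).comap
        (ratPullback (LinearMap.snd F W W) LinearMap.snd_surjective) := by
      rw [← adjoin_range_linForm, IntermediateField.adjoin_le_iff]
      rintro _ ⟨u, rfl⟩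
      change ratPullback _ LinearMap.snd_surjective _ ∈ IntermediateField.adjoin F (Set.range w)
      rw [ratPullback_snd_linForm, ← y.sum_repr u, map_sum]
      refine sum_mem fun k _ => ?_
      rw [map_smul]
      exact IntermediateField.smul_mem _
        (IntermediateField.subset_adjoin F (Set.range w) (Set.mem_range_self k))
    rintro _ ⟨x, -, rfl⟩
    exact h1 IntermediateField.mem_top
  have hle : genField (E.tilde y f) ⊔ E.sndInvariantField G₂
      ≤ IntermediateField.adjoin F (Set.range (Sum.elim t w)) := by
    refine sup_le (IntermediateField.adjoin.mono F _ _ ?_)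
      (hw.trans (IntermediateField.adjoin.mono F _ _ ?_))
    · rintro _ ⟨j, rfl⟩
      exact ⟨Sum.inl j, rfl⟩
    · rintro _ ⟨j, rfl⟩
      exact ⟨Sum.inr j, rfl⟩
  have hsep := isSeparable_over_sup (G₂ := G₂) hy hf hgen
  have hn : finrank F W = n := by
    rw [← Subspace.dual_finrank_eq, finrank_eq_card_basis y, Fintype.card_fin]
  have hind : AlgebraicIndependent F (Sum.elim t w) := by
    refine algebraicIndependent_of_isAlgebraic_adjoin
      (algebraicIndependent_linForm (finBasis F (Dual F (W × W)))) ?_ fun x => ?_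
    · simp [Subspace.dual_finrank_eq, hn]
    · exact (Algebra.IsSeparable.isSeparable
        (genField (E.tilde y f) ⊔ E.sndInvariantField G₂ :
          IntermediateField F (RatField F (W × W))) x).isIntegral.isAlgebraic.ringHom_of_comp_eq
        (IntermediateField.inclusion hle).toRingHom (RingHom.id _) (RingHom.injective _) rfl
  have h2 := IntermediateField.algebraicIndependent_adjoin_iff.2
    (AlgebraicIndependent.sumElim_iff.1 hind).2
  exact (linearDisjoint_adjoin_of_algebraicIndependent _ h2).of_le_right hw

end Main

end ParGlue


theorem theorem7p4 {F W : Type*} [Field F] [Finite F] [AddCommGroup W] [Module F W]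
    [FiniteDimensional F W] {ℓ n : ℕ} (E : ParGlue.PartialFlag F W ℓ)
    (G₁ G₂ : Subgroup E.parabolic)
    (y : Module.Basis (Fin n) F (Module.Dual F W)) (hy : E.BasisConsistent y)
    (f : Fin n → ParGlue.PolyRing F W)
    (hhom : ∀ j, ParGlue.IsHomogeneousPoly (f j))
    (hcons : E.SeqConsistent y f)
    (hgen : ParGlue.invariantField (E.stdRep G₁) = ParGlue.genField f) :
    ParGlue.invariantField
        (ParGlue.ParabolicGluing.rep : ParGlue.ParabolicGluing E G₁ G₂ →* _)
      = ParGlue.genField (E.tilde y f) ⊔ E.sndInvariantField G₂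
    ∧ (ParGlue.genField (E.tilde y f)).LinearDisjoint (E.sndInvariantField G₂) :=
  ⟨le_antisymm (ParGlue.invariantField_le_sup hy hcons hgen)
    (ParGlue.sup_le_invariantField hy hcons hgen),
    ParGlue.linearDisjoint_tilde hy hcons hgen⟩
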